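/- Let $d\ge 1$ and let $\Omega\subset\mathbb R^d$ be a bounded open set with Lipschitz boundary (near each boundary point, after a rotation, $\Omega$ is the strict epigraph of a Lipschitz function). For $t\in[0,1]$ let $\widetilde H^t(\Omega)$ be the space of the real functions $w\in L^2(\Omega)$ whose extension by zero $\widetilde w$ belongs to $H^t(\mathbb R^d)$, with the norm $$\|w\|_{\widetilde H^t(\Omega)}^2=\int_{\mathbb R^d}(1+|\xi|^{2t})\,|\mathcal F(\widetilde w)(\xi)|^2\,d\xi ,\qquad \mathcal F(f)(\xi)=(2\pi)^{-d/2}\int_{\mathbb R^d}e^{-i x\cdot\xi}f(x)\,dx$$ (with $\mathcal F$ extended to $L^2(\mathbb R^d)$), and let $H^{-t}(\Omega)$ be the dual of $\widetilde H^t(\Omega)$ with the operator norm. There is a constant $C>0$ that depends only on $\Omega$ such that the following holds for all $t\in[\tfrac12,1]$ and all solenoidal $\beta\in C^1(\overline\Omega,\mathbb R^d)$, i.e. $\operatorname{div}\beta=0$ in $\Omega$ (here $\beta\in C^1(\overline\Omega,\mathbb R^d)$ means that $\beta$ is continuously differentiable in $\Omega$ and that $\beta$ and its derivative extend continuously to $\overline\Omega$).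 1. For every $v\in\widetilde H^t(\Omega)$, the distribution $\beta\cdot\nabla v$, that is $\varphi\mapsto-\int_\Omega v\operatorname{div}(\varphi\beta)\,dx$ for $\varphi\in C_0^\infty(\Omega)$, extends uniquely to an element of $H^{-t}(\Omega)$, and $$\|\beta\cdot\nabla v\|_{H^{-t}(\Omega)}\le C\,\|\beta\|_{L^\infty(\Omega,\mathbb R^d)}\,\|v\|_{\widetilde H^t(\Omega)} .$$ 2. The bilinear form $\mathcal D(v,w)=\int_\Omega(\beta\cdot\nabla v)\,w\,dx$, defined for $v,w\in C_0^\infty(\Omega)$, has a unique extension to a continuous bilinear form, again denoted by $\mathcal D$, on $\widetilde H^t(\Omega)\times\widetilde H^t(\Omega)$. 3. This extension satisfies $\mathcal D(v,v)=0$ for all $v\in\widetilde H^t(\Omega)$. -/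

import Mathlib

open MeasureTheory TopologicalSpace Set
open scoped FourierTransform Distributions ENNReal NNReal

noncomputable section

/-- The Euclidean space `ℝᵈ`. -/
abbrev Rd (d : ℕ) : Type := EuclideanSpace ℝ (Fin d)

variable {d : ℕ}

/-- The boundary of `Ω` is Lipschitz: near every boundary point, and after a choice of a unit
direction `e`, the set `Ω` is the strict epigraph of a Lipschitz function `γ` of the `d - 1`
coordinates orthogonal to `e` (that is, `γ` is constant in the direction `e`). -/
def HasLipschitzBoundary (Ω : Set (Rd d)) : Prop :=
  ∀ x₀ ∈ frontier Ω, ∃ (e : Rd d) (γ : Rd d → ℝ) (K : ℝ≥0) (U : Set (Rd d)),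
    ‖e‖ = 1 ∧ LipschitzWith K γ ∧ (∀ (x : Rd d) (s : ℝ), γ (x + s • e) = γ x) ∧
      IsOpen U ∧ x₀ ∈ U ∧ Ω ∩ U = {x | x ∈ U ∧ γ x < inner ℝ e x}

/-- `β ∈ C¹(closure Ω, ℝᵈ)`: `β` is continuously differentiable in the open set `Ω`, and `β` and
its derivative extend continuously up to the boundary. -/
def IsC1UpToBoundary (Ω : Opens (Rd d)) (β : Rd d → Rd d) : Prop :=
  ContDiffOn ℝ 1 β Ω ∧ ContinuousOn β (closure (Ω : Set (Rd d))) ∧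
    ∃ B : Rd d → (Rd d →L[ℝ] Rd d),
      ContinuousOn B (closure (Ω : Set (Rd d))) ∧ ∀ x ∈ Ω, B x = fderiv ℝ β x

/-- The divergence `∑ᵢ ∂ᵢ βᵢ` of a vector field. -/
def divergence (β : Rd d → Rd d) (x : Rd d) : ℝ :=
  ∑ i : Fin d, (fderiv ℝ β x (EuclideanSpace.single i 1)) i

/-- `div β = 0` in `Ω`. -/
def IsSolenoidal (Ω : Opens (Rd d)) (β : Rd d → Rd d) : Prop :=
  ∀ x ∈ Ω, divergence β x = 0

/-- The norm of `β` in `L^∞(Ω, ℝᵈ)`. -/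
def supNorm (Ω : Opens (Rd d)) (β : Rd d → Rd d) : ℝ :=
  (eLpNorm β ∞ (volume.restrict (Ω : Set (Rd d)))).toReal

/-- The real space `L²(Ω)`. -/
abbrev L2 (Ω : Opens (Rd d)) : Type := Lp ℝ 2 (volume.restrict (Ω : Set (Rd d)))

theorem memLp_zeroExtend (Ω : Opens (Rd d)) {w : Rd d → ℝ}
    (hw : MemLp w 2 (volume.restrict (Ω : Set (Rd d)))) :
    MemLp ((Ω : Set (Rd d)).indicator fun x ↦ (w x : ℂ)) 2 volume :=
  (memLp_indicator_iff_restrict Ω.isOpen.measurableSet).2 hw.ofReal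

/-- Extension by zero of a function in `L²(Ω)` to `ℝᵈ`, as a complex-valued function so that its
Fourier transform can be taken. -/
def zeroExtend (Ω : Opens (Rd d)) : L2 Ω →ₗ[ℝ] Lp ℂ 2 (volume : Measure (Rd d)) where
  toFun w := (memLp_zeroExtend Ω (Lp.memLp w)).toLp _
  map_add' v w := by
    rw [← MemLp.toLp_add]
    apply MemLp.toLp_congr
    have h := (ae_restrict_iff' Ω.isOpen.measurableSet).1 (Lp.coeFn_add v w)
    filter_upwards [h] with x hx
    by_cases hxΩ : x ∈ (Ω : Set (Rd d))
    · have hx' : (v + w : L2 Ω) x = v x + w x := hx hxΩ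
      simp only [indicator_of_mem hxΩ, Pi.add_apply, hx', Complex.ofReal_add]
    · simp [hxΩ]
  map_smul' c w := by
    rw [RingHom.id_apply, ← MemLp.toLp_const_smul]
    apply MemLp.toLp_congr
    have h := (ae_restrict_iff' Ω.isOpen.measurableSet).1 (Lp.coeFn_smul c w)
    filter_upwards [h] with x hx
    by_cases hxΩ : x ∈ (Ω : Set (Rd d))
    · have hx' : (c • w : L2 Ω) x = c * w x := hx hxΩ
      simp only [indicator_of_mem hxΩ, Pi.smul_apply, hx', Complex.ofReal_mul, Complex.real_smul]
    · simp [hxΩ]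

theorem coeFn_zeroExtend (Ω : Opens (Rd d)) (w : L2 Ω) :
    zeroExtend Ω w =ᵐ[volume] (Ω : Set (Rd d)).indicator fun x ↦ (w x : ℂ) :=
  (memLp_zeroExtend Ω (Lp.memLp w)).coeFn_toLp

theorem zeroExtend_injective (Ω : Opens (Rd d)) : Function.Injective (zeroExtend Ω) := by
  intro v w h
  apply Lp.ext
  rw [Filter.EventuallyEq, ae_restrict_iff' Ω.isOpen.measurableSet]
  have hv := coeFn_zeroExtend Ω v
  rw [h] at hv
  filter_upwards [hv, coeFn_zeroExtend Ω w] with x h1 h2 hx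
  rw [h1] at h2
  have h3 : ((v x : ℝ) : ℂ) = (w x : ℂ) := by simpa [hx] using h2
  exact_mod_cast h3

/-- The weight `1 + |η|^{2t}` of the space `H^t(ℝᵈ)`, as a function of the frequency `ξ` for which
the Fourier kernel is `exp(-2πi x·ξ)`, so that the angular frequency is `η = 2πξ`. -/
def sobolevWeight (t : ℝ) (ξ : Rd d) : ℝ := 1 + (2 * Real.pi * ‖ξ‖) ^ (2 * t)

theorem sobolevWeight_pos (t : ℝ) (ξ : Rd d) : 0 < sobolevWeight t ξ := by
  unfold sobolevWeight
  positivity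

/-- The square root of the weight times the Fourier transform of `f`. The norm of `f` in
`H^t(ℝᵈ)` is the `L²` norm of this function. -/
def weightedFourier (t : ℝ) (f : Lp ℂ 2 (volume : Measure (Rd d))) (ξ : Rd d) : ℂ :=
  Real.sqrt (sobolevWeight t ξ) • (𝓕 f : Lp ℂ 2 (volume : Measure (Rd d))) ξ

theorem weightedFourier_add (t : ℝ) (f g : Lp ℂ 2 (volume : Measure (Rd d))) :
    weightedFourier t (f + g) =ᵐ[volume] weightedFourier t f + weightedFourier t g := by
  have h : (𝓕 (f + g) : Lp ℂ 2 (volume : Measure (Rd d))) = 𝓕 f + 𝓕 g :=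
    (Lp.fourierTransformₗᵢ (Rd d) ℂ).map_add f g
  filter_upwards [Lp.coeFn_add (𝓕 f : Lp ℂ 2 (volume : Measure (Rd d))) (𝓕 g)] with ξ hξ
  simp only [weightedFourier, h, hξ, Pi.add_apply, smul_add]

theorem weightedFourier_smul (t c : ℝ) (f : Lp ℂ 2 (volume : Measure (Rd d))) :
    weightedFourier t (c • f) =ᵐ[volume] c • weightedFourier t f := by
  have h0 : c • f = (c : ℂ) • f := by
    apply Lp.ext
    filter_upwards [Lp.coeFn_smul c f, Lp.coeFn_smul (c : ℂ) f] with x h1 h2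
    rw [h1, h2, Pi.smul_apply, Pi.smul_apply, Complex.real_smul, smul_eq_mul]
  have h : (𝓕 (c • f) : Lp ℂ 2 (volume : Measure (Rd d))) = (c : ℂ) • 𝓕 f := by
    rw [h0]
    exact (Lp.fourierTransformₗᵢ (Rd d) ℂ).map_smul (c : ℂ) f
  filter_upwards [Lp.coeFn_smul (c : ℂ) (𝓕 f : Lp ℂ 2 (volume : Measure (Rd d)))] with ξ hξ
  simp only [weightedFourier, h, hξ, Pi.smul_apply, Complex.real_smul, smul_eq_mul]
  ring

/-- The functions in `L²(Ω)` whose extension by zero belongs to `H^t(ℝᵈ)`. -/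
def tildeHSubmodule (Ω : Opens (Rd d)) (t : ℝ) : Submodule ℝ (L2 Ω) where
  carrier := {w | MemLp (weightedFourier t (zeroExtend Ω w)) 2 volume}
  zero_mem' := by
    have h := weightedFourier_smul t 0 (0 : Lp ℂ 2 (volume : Measure (Rd d)))
    rw [zero_smul, zero_smul] at h
    change MemLp (weightedFourier t (zeroExtend Ω (0 : L2 Ω))) 2 volume
    rw [map_zero]
    exact (memLp_congr_ae h).2 MemLp.zero
  add_mem' {v w} hv hw := by
    change MemLp (weightedFourier t (zeroExtend Ω (v + w))) 2 volume
    rw [map_add]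
    exact (memLp_congr_ae (weightedFourier_add t _ _)).2 (hv.add hw)
  smul_mem' c w hw := by
    change MemLp (weightedFourier t (zeroExtend Ω (c • w))) 2 volume
    rw [map_smul]
    exact (memLp_congr_ae (weightedFourier_smul t c _)).2 (hw.const_smul c)

/-- The space `H̃^t(Ω)` of the functions in `L²(Ω)` whose extension by zero belongs to
`H^t(ℝᵈ)`. It is not a `Submodule`, since its norm is not the norm of `L²(Ω)`. -/
def TildeH (Ω : Opens (Rd d)) (t : ℝ) : Type := tildeHSubmodule Ω t

namespace TildeH

variable {Ω : Opens (Rd d)} {t : ℝ}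

instance : AddCommGroup (TildeH Ω t) := inferInstanceAs (AddCommGroup (tildeHSubmodule Ω t))

instance : Module ℝ (TildeH Ω t) := inferInstanceAs (Module ℝ (tildeHSubmodule Ω t))

/-- The inclusion of `H̃^t(Ω)` in `L²(Ω)`. -/
def toL2 : TildeH Ω t →ₗ[ℝ] L2 Ω := (tildeHSubmodule Ω t).subtype

theorem memLp_weightedFourier (w : TildeH Ω t) :
    MemLp (weightedFourier t (zeroExtend Ω (toL2 w))) 2 volume := w.2

/-- The map whose `L²` norm is the norm of `H̃^t(Ω)`. -/
def toWeighted : TildeH Ω t →ₗ[ℝ] Lp ℂ 2 (volume : Measure (Rd d)) where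
  toFun w := (memLp_weightedFourier w).toLp _
  map_add' v w := by
    rw [← MemLp.toLp_add]
    apply MemLp.toLp_congr
    rw [map_add, map_add]
    exact weightedFourier_add t _ _
  map_smul' c w := by
    rw [RingHom.id_apply, ← MemLp.toLp_const_smul]
    apply MemLp.toLp_congr
    rw [map_smul, map_smul]
    exact weightedFourier_smul t c _

theorem toWeighted_injective : Function.Injective (toWeighted (Ω := Ω) (t := t)) := by
  intro v w h
  have h1 := (MemLp.toLp_eq_toLp_iff (memLp_weightedFourier v) (memLp_weightedFourier w)).1 h
  have h2 : (𝓕 (zeroExtend Ω (toL2 v)) : Lp ℂ 2 (volume : Measure (Rd d))) =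
      𝓕 (zeroExtend Ω (toL2 w)) := by
    apply Lp.ext
    filter_upwards [h1] with ξ hξ
    have h0 : Real.sqrt (sobolevWeight t ξ) ≠ 0 := (Real.sqrt_pos.2 (sobolevWeight_pos t ξ)).ne'
    exact smul_right_injective ℂ h0 hξ
  have h3 := (Lp.fourierTransformₗᵢ (Rd d) ℂ).injective h2
  exact Subtype.ext (zeroExtend_injective Ω h3)

instance : NormedAddCommGroup (TildeH Ω t) :=
  NormedAddCommGroup.induced (TildeH Ω t) (Lp ℂ 2 (volume : Measure (Rd d))) toWeighted
    toWeighted_injective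

instance : NormedSpace ℝ (TildeH Ω t) :=
  NormedSpace.induced ℝ (TildeH Ω t) (Lp ℂ 2 (volume : Measure (Rd d))) toWeighted

theorem norm_eq (w : TildeH Ω t) : ‖w‖ = ‖toWeighted w‖ := rfl

/-- The norm of `H̃^t(Ω)` is the norm in `H^t(ℝᵈ)` of the extension by zero. -/
theorem norm_sq_eq (w : TildeH Ω t) :
    ‖w‖ ^ 2 = ∫ ξ : Rd d, sobolevWeight t ξ *
      ‖(𝓕 (zeroExtend Ω (toL2 w)) : Lp ℂ 2 (volume : Measure (Rd d))) ξ‖ ^ 2 := by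
  have h : ‖toWeighted w‖ ^ 2 = ∫ ξ : Rd d, ‖toWeighted w ξ‖ ^ 2 := by
    have h0 := L2.inner_def (𝕜 := ℂ) (toWeighted w) (toWeighted w)
    simp only [inner_self_eq_norm_sq_to_K] at h0
    have h1 : ∀ ξ, (((‖toWeighted w ξ‖ : ℝ) : ℂ)) ^ 2 = ((‖toWeighted w ξ‖ ^ 2 : ℝ) : ℂ) := by
      intro ξ
      push_cast
      rfl
    have h2 : ((‖toWeighted w‖ ^ 2 : ℝ) : ℂ) = ((∫ ξ : Rd d, ‖toWeighted w ξ‖ ^ 2 : ℝ) : ℂ) := by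
      rw [← integral_complex_ofReal]
      push_cast
      exact h0
    exact_mod_cast h2
  rw [norm_eq, h]
  apply integral_congr_ae
  filter_upwards [(memLp_weightedFourier w).coeFn_toLp] with ξ hξ
  have h3 : toWeighted w ξ = weightedFourier t (zeroExtend Ω (toL2 w)) ξ := hξ
  simp only [h3, weightedFourier, norm_smul, mul_pow, Real.norm_eq_abs, sq_abs,
    Real.sq_sqrt (sobolevWeight_pos t ξ).le]

end TildeH

/-- The space `H^{-t}(Ω)`, the dual of `H̃^t(Ω)` with the operator norm. -/
abbrev HNeg (Ω : Opens (Rd d)) (t : ℝ) : Type := StrongDual ℝ (TildeH Ω t)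

theorem memLp_testFunction {Ω : Opens (Rd d)} (φ : 𝓓(Ω, ℝ)) :
    MemLp φ 2 (volume.restrict (Ω : Set (Rd d))) :=
  (φ.continuous.memLp_of_hasCompactSupport φ.hasCompactSupport).restrict _

/-- A test function as a Schwartz function. -/
def testToSchwartz {Ω : Opens (Rd d)} (φ : 𝓓(Ω, ℝ)) : SchwartzMap (Rd d) ℂ :=
  HasCompactSupport.toSchwartzMap (f := fun x ↦ (φ x : ℂ))
    (φ.hasCompactSupport.comp_left (g := fun r : ℝ ↦ (r : ℂ)) Complex.ofReal_zero)
    (Complex.ofRealCLM.contDiff.comp φ.contDiff)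

theorem testToSchwartz_apply {Ω : Opens (Rd d)} (φ : 𝓓(Ω, ℝ)) (x : Rd d) :
    testToSchwartz φ x = (φ x : ℂ) := rfl

theorem zeroExtend_testFunction {Ω : Opens (Rd d)} (φ : 𝓓(Ω, ℝ)) :
    zeroExtend Ω ((memLp_testFunction φ).toLp φ) = (testToSchwartz φ).toLp 2 := by
  apply Lp.ext
  have h1 := (ae_restrict_iff' Ω.isOpen.measurableSet).1 (memLp_testFunction φ).coeFn_toLp
  filter_upwards [coeFn_zeroExtend Ω ((memLp_testFunction φ).toLp φ), h1,
    (testToSchwartz φ).coeFn_toLp 2] with x h2 h3 h4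
  rw [h2, h4]
  by_cases hx : x ∈ (Ω : Set (Rd d))
  · rw [indicator_of_mem hx, h3 hx, testToSchwartz_apply]
  · have h5 : φ x = 0 := by
      by_contra h
      exact hx (φ.tsupport_subset (subset_tsupport _ h))
    rw [indicator_of_notMem hx, testToSchwartz_apply, h5, Complex.ofReal_zero]

theorem sqrt_sobolevWeight_le {t : ℝ} (ht : 0 ≤ t) (ξ : Rd d) :
    Real.sqrt (sobolevWeight t ξ) ≤
      Real.sqrt (1 + (2 * Real.pi) ^ (2 * t)) * (1 + ‖ξ‖ ^ 2) ^ ⌈t⌉₊ := by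
  have h0 : (1 : ℝ) ≤ 1 + ‖ξ‖ ^ 2 := by nlinarith [sq_nonneg ‖ξ‖]
  have h1 : ‖ξ‖ ^ (2 * t) ≤ ((1 + ‖ξ‖ ^ 2) ^ ⌈t⌉₊) ^ 2 := by
    calc ‖ξ‖ ^ (2 * t) = (‖ξ‖ ^ 2) ^ t := by
          rw [Real.rpow_mul (norm_nonneg _), Real.rpow_two]
      _ ≤ (1 + ‖ξ‖ ^ 2) ^ t := by gcongr; linarith
      _ ≤ (1 + ‖ξ‖ ^ 2) ^ ((⌈t⌉₊ : ℕ) : ℝ) :=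
          Real.rpow_le_rpow_of_exponent_le h0 (Nat.le_ceil t)
      _ = (1 + ‖ξ‖ ^ 2) ^ ⌈t⌉₊ := Real.rpow_natCast _ _
      _ ≤ ((1 + ‖ξ‖ ^ 2) ^ ⌈t⌉₊) ^ 2 := le_self_pow₀ (one_le_pow₀ h0) two_ne_zero
  have h2 : (1 : ℝ) ≤ ((1 + ‖ξ‖ ^ 2) ^ ⌈t⌉₊) ^ 2 := one_le_pow₀ (one_le_pow₀ h0)
  apply Real.sqrt_le_iff.2
  refine ⟨by positivity, ?_⟩
  rw [mul_pow, Real.sq_sqrt (by positivity), sobolevWeight,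
    Real.mul_rpow (by positivity) (norm_nonneg _), add_mul, one_mul]
  gcongr

theorem testFunction_mem_tildeH {Ω : Opens (Rd d)} {t : ℝ} (ht : 0 ≤ t) (φ : 𝓓(Ω, ℝ)) :
    (memLp_testFunction φ).toLp φ ∈ tildeHSubmodule Ω t := by
  change MemLp (weightedFourier t (zeroExtend Ω ((memLp_testFunction φ).toLp φ))) 2 volume
  rw [zeroExtend_testFunction]
  set F : SchwartzMap (Rd d) ℂ := 𝓕 (testToSchwartz φ) with hF
  have hg : Function.HasTemperateGrowth fun ξ : Rd d ↦ (1 + ‖ξ‖ ^ 2) ^ ⌈t⌉₊ := by fun_prop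
  have hM : MemLp (SchwartzMap.smulLeftCLM ℂ (fun ξ : Rd d ↦ (1 + ‖ξ‖ ^ 2) ^ ⌈t⌉₊) F) 2 volume :=
    SchwartzMap.memLp _ 2 volume
  have hw : Continuous fun ξ : Rd d ↦ Real.sqrt (sobolevWeight t ξ) := by
    unfold sobolevWeight
    have : Continuous fun ξ : Rd d ↦ (2 * Real.pi * ‖ξ‖) ^ (2 * t) :=
      (by fun_prop : Continuous fun ξ : Rd d ↦ 2 * Real.pi * ‖ξ‖).rpow_const
        fun _ ↦ Or.inr (by positivity)
    fun_prop
  refine MemLp.of_le_mul (c := Real.sqrt (1 + (2 * Real.pi) ^ (2 * t))) hM ?_ ?_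
  · exact hw.aestronglyMeasurable.smul (Lp.aestronglyMeasurable _)
  · have h : (𝓕 ((testToSchwartz φ).toLp 2) : Lp ℂ 2 (volume : Measure (Rd d))) = F.toLp 2 :=
      SchwartzMap.toLp_fourier_eq _
    filter_upwards [F.coeFn_toLp 2] with ξ hξ
    rw [weightedFourier, h, hξ, SchwartzMap.smulLeftCLM_apply_apply hg, norm_smul, norm_smul,
      ← mul_assoc, Real.norm_of_nonneg (Real.sqrt_nonneg _),
      Real.norm_of_nonneg (by positivity : (0 : ℝ) ≤ (1 + ‖ξ‖ ^ 2) ^ ⌈t⌉₊)]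
    gcongr
    exact sqrt_sobolevWeight_le ht ξ

/-- The inclusion of `C₀^∞(Ω)` in `H̃^t(Ω)`. -/
def TildeH.ofTest {Ω : Opens (Rd d)} {t : ℝ} (ht : 0 ≤ t) (φ : 𝓓(Ω, ℝ)) : TildeH Ω t :=
  ⟨(memLp_testFunction φ).toLp φ, testFunction_mem_tildeH ht φ⟩

/-- The distribution `β · ∇v = ∑ᵢ βᵢ ∂ᵢv` in `Ω`, for `v ∈ L²(Ω)` and `β` of class `C¹` in `Ω`:
its value at a test function `φ` is `-∫_Ω v ∑ᵢ ∂ᵢ(φ βᵢ)`. -/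
def driftDistribution (Ω : Opens (Rd d)) (β : Rd d → Rd d) (v : L2 Ω) (φ : 𝓓(Ω, ℝ)) : ℝ :=
  -∫ x in (Ω : Set (Rd d)), v x * divergence (fun y ↦ φ y • β y) x

/-- The distribution `β · ∇v` is given by the element `ℓ` of `H^{-t}(Ω)`. -/
def IsDriftTerm {Ω : Opens (Rd d)} {t : ℝ} (ht : 0 ≤ t) (β : Rd d → Rd d) (v : TildeH Ω t)
    (ℓ : HNeg Ω t) : Prop :=
  ∀ φ : 𝓓(Ω, ℝ), ℓ (TildeH.ofTest ht φ) = driftDistribution Ω β (TildeH.toL2 v) φ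

/-- The drift form `∫_Ω (β · ∇φ) ψ` on test functions. -/
def driftForm (Ω : Opens (Rd d)) (β : Rd d → Rd d) (φ ψ : 𝓓(Ω, ℝ)) : ℝ :=
  ∫ x in (Ω : Set (Rd d)), fderiv ℝ φ x (β x) * ψ x

/-- The continuous bilinear form `D` on `H̃^t(Ω) × H̃^t(Ω)` extends the drift form. -/
def ExtendsDriftForm {Ω : Opens (Rd d)} {t : ℝ} (ht : 0 ≤ t) (β : Rd d → Rd d)
    (D : TildeH Ω t →L[ℝ] TildeH Ω t →L[ℝ] ℝ) : Prop :=
  ∀ φ ψ : 𝓓(Ω, ℝ), D (TildeH.ofTest ht φ) (TildeH.ofTest ht ψ) = driftForm Ω β φ ψ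

end

/-! The theorem is an interpolation result at the midpoint 1/2. Cauchy–Schwarz bounds `D(φ, ψ) = ∫
(β · ∇φ) ψ` by `‖β‖_∞ ‖∇φ‖ ‖ψ‖` in `L²`. Since `div β = 0`, integration by parts gives `D(φ, ψ) =
-D(ψ, φ)` (`driftForm_antisymm`), so the derivative may fall on either argument. Halfway between the
two bounds lies one in `H̃^{1/2} × H̃^{1/2}`, linear in `‖β‖_∞` and free of derivatives of `β`.

The interpolation is carried out by hand. The Lipschitz boundary yields a finite partition of unity
`χᵢ` and mollifiers `ηᵢ` that push the support of `χᵢ v` into `Ω`. Hence `vₙ = Σᵢ (χᵢ v) * ηᵢ,ₙ`,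
with `ηᵢ,ₙ` the rescaling to size `2⁻ⁿ`, is a test function in `Ω` (`ShiftCover.smooth`), and `vₙ →
v` in `H̃^t` for `0 ≤ t ≤ 1` (`tendsto_ofTest_smooth`), which also gives density. The square
function estimate (`exists_squareFunction_le`) bounds `Σ 2ⁿ ‖vₙ₊₁ - vₙ‖²` and `Σ 2⁻ⁿ ‖∇vₙ‖²` by the
squared `H̃^{1/2}` norm of `v`.

For test functions `φ, ψ` with smoothings `aₙ, bₙ`, `D(φ, ψ)` is the limit of a telescoping sum with
increments `D(aₙ, bₙ₊₁ - bₙ) - D(bₙ₊₁, aₙ₊₁ - aₙ)`. Antisymmetry has put each gradient on the smooth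
factor, so Young's inequality with weight `2ⁿ` and the square function estimate sum the series
(`ShiftCover.exists_abs_driftForm_le`).

For `t ≥ 1/2` the norm of `H̃^t` controls that of `H̃^{1/2}` with a constant independent of `t`.
Density then gives existence and uniqueness of the extensions, and carries `D(φ, φ) = 0` over to
them. -/

open MeasureTheory TopologicalSpace Set
open scoped FourierTransform Distributions ENNReal NNReal Convolution Pointwise

noncomputable section

variable {d : ℕ}

/-! ### Pointwise Fourier transforms and weighted energies -/

/-- On `L¹ ∩ L²` the Fourier transform of `L²` is the classical one. -/
theorem fourier_toLp_ae_eq {f : Rd d → ℂ} (h1 : Integrable f) (h2 : MemLp f 2) :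
    (𝓕 (h2.toLp f) : Lp ℂ 2 (volume : Measure (Rd d))) =ᵐ[volume] 𝓕 f := by
  have hcont : Continuous (𝓕 f) :=
    VectorFourier.fourierIntegral_continuous Real.continuous_fourierChar
      (by exact continuous_inner) h1
  -- Both sides are locally integrable, so it suffices to pair them with smooth compactly supported
  -- `g`. The `L²` transform agrees with the distributional one, which moves the transform onto `g`;
  -- the multiplication formula moves it back onto `f`.
  refine ae_eq_of_integral_contDiff_smul_eq
    ((Lp.memLp (𝓕 (h2.toLp f) : Lp ℂ 2 (volume : Measure (Rd d)))).locallyIntegrable (by norm_num))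
    hcont.locallyIntegrable fun g hg hgc ↦ ?_
  set G : SchwartzMap (Rd d) ℂ := HasCompactSupport.toSchwartzMap (f := fun x ↦ (g x : ℂ))
    (hgc.comp_left (g := fun r : ℝ ↦ (r : ℂ)) Complex.ofReal_zero)
    (Complex.ofRealCLM.contDiff.comp hg) with hG
  have hGg : ∀ x, G x = (g x : ℂ) := fun x ↦ rfl
  have h := DFunLike.congr_fun (Lp.fourier_toTemperedDistribution_eq (h2.toLp f)) G
  rw [TemperedDistribution.fourier_apply, Lp.toTemperedDistribution_apply,
    Lp.toTemperedDistribution_apply] at h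
  have h3 : ∫ x, (𝓕 G) x • (h2.toLp f) x = ∫ x, (𝓕 G) x • f x := by
    apply integral_congr_ae
    filter_upwards [h2.coeFn_toLp] with x hx
    rw [hx]
  have h4 : ∫ ξ, (𝓕 (G : Rd d → ℂ)) ξ • f ξ = ∫ x, G x • (𝓕 f) x :=
    VectorFourier.integral_fourierIntegral_smul_eq_flip (L := innerₗ (Rd d))
      Real.continuous_fourierChar continuous_inner G.integrable h1 |>.trans <| by
        rw [flip_innerₗ]; rfl
  rw [h3, SchwartzMap.fourier_coe, h4] at h
  simp only [hGg, smul_eq_mul] at h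
  simpa only [Complex.real_smul] using h.symm

theorem continuous_fourier {f : Rd d → ℂ} (h1 : Integrable f) : Continuous (𝓕 f) :=
  VectorFourier.fourierIntegral_continuous Real.continuous_fourierChar
      (by exact continuous_inner) h1

/-- The quadratic functional `∫ w |𝓕 f|²`. -/
def energy (w : Rd d → ℝ) (f : Rd d → ℂ) : ℝ≥0∞ :=
  ∫⁻ ξ, ENNReal.ofReal (w ξ) * ‖𝓕 f ξ‖ₑ ^ 2

theorem energy_congr {w : Rd d → ℝ} {f g : Rd d → ℂ} (h : f =ᵐ[volume] g) :
    energy w f = energy w g := by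
  rw [energy, energy, show 𝓕 f = 𝓕 g from funext (Real.fourier_congr_ae h)]

/-- The zero extension of an element of `L²(Ω)`, as a function. -/
def zeroExt (Ω : Opens (Rd d)) (w : L2 Ω) : Rd d → ℂ :=
  (Ω : Set (Rd d)).indicator fun x ↦ (w x : ℂ)

theorem memLp_zeroExt (Ω : Opens (Rd d)) (w : L2 Ω) : MemLp (zeroExt Ω w) 2 :=
  memLp_zeroExtend Ω (Lp.memLp w)

theorem integrable_zeroExt {Ω : Opens (Rd d)} (hΩ : Bornology.IsBounded (Ω : Set (Rd d)))
    (w : L2 Ω) : Integrable (zeroExt Ω w) := by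
  have : IsFiniteMeasure (volume.restrict (Ω : Set (Rd d))) :=
    isFiniteMeasure_restrict.2 hΩ.measure_lt_top.ne
  rw [zeroExt, integrable_indicator_iff Ω.isOpen.measurableSet]
  exact ((Lp.memLp w).integrable (by norm_num)).ofReal

theorem fourier_zeroExtend_ae_eq {Ω : Opens (Rd d)}
    (hΩ : Bornology.IsBounded (Ω : Set (Rd d))) (w : L2 Ω) :
    (𝓕 (zeroExtend Ω w) : Lp ℂ 2 (volume : Measure (Rd d))) =ᵐ[volume] 𝓕 (zeroExt Ω w) :=
  fourier_toLp_ae_eq (integrable_zeroExt hΩ w) (memLp_zeroExt Ω w)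

/-- Plancherel's theorem on `L¹ ∩ L²`. -/
theorem energy_one {f : Rd d → ℂ} (h1 : Integrable f) (h2 : MemLp f 2) :
    energy (fun _ ↦ 1) f = eLpNorm f 2 volume ^ 2 := by
  have h3 : eLpNorm (𝓕 f) 2 volume = eLpNorm f 2 volume := by
    rw [← eLpNorm_congr_ae (fourier_toLp_ae_eq h1 h2), ← eLpNorm_congr_ae h2.coeFn_toLp,
      ← Lp.enorm_def, ← Lp.enorm_def, ← ofReal_norm, ← ofReal_norm, Lp.norm_fourier_eq]
  have h4 := eLpNorm_nnreal_pow_eq_lintegral (p := 2) (μ := volume) (f := 𝓕 f) (by norm_num)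
  simp only [NNReal.coe_ofNat, ENNReal.coe_ofNat, ENNReal.rpow_ofNat] at h4
  simp [← h3, h4, energy]

namespace TildeH

variable {Ω : Opens (Rd d)} {t : ℝ}

/-- Boundedness of `Ω` puts the zero extension in `L¹`, so the norm can be computed from a
continuous Fourier transform defined at every point. -/
theorem enorm_sq_eq_energy (hΩ : Bornology.IsBounded (Ω : Set (Rd d))) (w : TildeH Ω t) :
    ENNReal.ofReal (‖w‖ ^ 2) = energy (sobolevWeight t) (zeroExt Ω (toL2 w)) := by
  rw [norm_eq, toWeighted]
  simp only [LinearMap.coe_mk, AddHom.coe_mk]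
  rw [ENNReal.ofReal_pow (norm_nonneg _), ofReal_norm, Lp.enorm_toLp]
  have := eLpNorm_nnreal_pow_eq_lintegral (p := 2) (μ := volume)
    (f := weightedFourier t (zeroExtend Ω (toL2 w))) (by norm_num)
  simp only [NNReal.coe_ofNat, ENNReal.coe_ofNat, ENNReal.rpow_ofNat] at this
  rw [this, energy]
  apply lintegral_congr_ae
  filter_upwards [fourier_zeroExtend_ae_eq hΩ (toL2 w)] with ξ hξ
  rw [weightedFourier, hξ, enorm_smul, mul_pow, Real.enorm_of_nonneg (Real.sqrt_nonneg _),
    ← ENNReal.ofReal_pow (Real.sqrt_nonneg _), Real.sq_sqrt (sobolevWeight_pos t ξ).le]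

end TildeH

/-! ### Multiplication by Schwartz functions in `H^t` -/

/-- A Peetre inequality, uniform in `t ∈ [0, 1]`. In the constant 5, 4 comes from `(1 + b)^{2t} ≤ 4
(1 + b^{2t})` and 1 from the summand 1 of the weight. -/
theorem sobolevWeight_le_mul {t : ℝ} (ht₀ : 0 ≤ t) (ht₁ : t ≤ 1) (ξ η : Rd d) :
    sobolevWeight t ξ ≤ 5 * (1 + 2 * Real.pi * ‖η‖) ^ 2 * sobolevWeight t (ξ + η) := by
  unfold sobolevWeight
  set a := 2 * Real.pi * ‖η‖
  set b := 2 * Real.pi * ‖ξ + η‖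
  set c := 2 * Real.pi * ‖ξ‖
  have ha : 0 ≤ a := by positivity
  have hb : 0 ≤ b := by positivity
  have hc : 0 ≤ c := by positivity
  have hcab : c ≤ a + b := by
    have h : ‖ξ‖ ≤ ‖η‖ + ‖ξ + η‖ := by
      calc ‖ξ‖ = ‖(ξ + η) - η‖ := by simp
        _ ≤ ‖ξ + η‖ + ‖η‖ := norm_sub_le _ _
        _ = _ := add_comm _ _
    calc c ≤ 2 * Real.pi * (‖η‖ + ‖ξ + η‖) := mul_le_mul_of_nonneg_left h (by positivity)
      _ = a + b := by ring
  have h1 : (1 + a) ^ (2 * t) ≤ (1 + a) ^ 2 := by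
    rw [← Real.rpow_two]
    exact Real.rpow_le_rpow_of_exponent_le (by linarith) (by linarith)
  have h2 : (1 + b) ^ (2 * t) ≤ 4 * (1 + b ^ (2 * t)) := by
    have h3 : (2 : ℝ) ^ (2 * t) ≤ 4 := by
      calc (2 : ℝ) ^ (2 * t) ≤ 2 ^ (2 : ℝ) :=
            Real.rpow_le_rpow_of_exponent_le (by norm_num) (by linarith)
        _ = 4 := by norm_num
    have h4 : 0 ≤ b ^ (2 * t) := by positivity
    rcases le_total b 1 with hb1 | hb1
    · calc (1 + b) ^ (2 * t) ≤ 2 ^ (2 * t) := by gcongr; linarith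
        _ ≤ 4 * (1 + b ^ (2 * t)) := by linarith
    · calc (1 + b) ^ (2 * t) ≤ (2 * b) ^ (2 * t) := by gcongr; linarith
        _ = 2 ^ (2 * t) * b ^ (2 * t) := Real.mul_rpow (by norm_num) hb
        _ ≤ 4 * b ^ (2 * t) := by gcongr
        _ ≤ 4 * (1 + b ^ (2 * t)) := by linarith
  have h5 : c ^ (2 * t) ≤ (1 + a) ^ 2 * (4 * (1 + b ^ (2 * t))) := by
    calc c ^ (2 * t) ≤ ((1 + a) * (1 + b)) ^ (2 * t) := by gcongr; nlinarith
      _ = (1 + a) ^ (2 * t) * (1 + b) ^ (2 * t) := Real.mul_rpow (by linarith) (by linarith)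
      _ ≤ _ := by gcongr
  have h6 : 0 ≤ b ^ (2 * t) := by positivity
  have h7 : 1 ≤ (1 + a) ^ 2 * (1 + b ^ (2 * t)) :=
    one_le_mul_of_one_le_of_one_le (one_le_pow₀ (by linarith)) (by linarith)
  nlinarith

theorem continuous_sobolevWeight {t : ℝ} (ht : 0 ≤ t) : Continuous (sobolevWeight (d := d) t) := by
  unfold sobolevWeight
  have : Continuous fun ξ : Rd d ↦ (2 * Real.pi * ‖ξ‖) ^ (2 * t) :=
    (by fun_prop : Continuous fun ξ : Rd d ↦ 2 * Real.pi * ‖ξ‖).rpow_const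
      fun _ ↦ Or.inr (by positivity)
  fun_prop

/-- Cauchy–Schwarz for the measure `f μ`, after splitting `f = f^{1/2} f^{1/2}`. -/
theorem sq_lintegral_mul_le {α : Type*} [MeasurableSpace α] {μ : Measure α} {f g : α → ℝ≥0∞}
    (hf : AEMeasurable f μ) (hg : AEMeasurable g μ) :
    (∫⁻ x, f x * g x ∂μ) ^ 2 ≤ (∫⁻ x, f x ∂μ) * ∫⁻ x, f x * g x ^ 2 ∂μ := by
  have h := ENNReal.lintegral_mul_le_Lp_mul_Lq μ (p := 2) (q := 2)
    (by constructor <;> norm_num) (hf.pow_const (1 / 2 : ℝ)) ((hf.pow_const (1 / 2 : ℝ)).mul hg)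
  have e1 : ∀ a : ℝ≥0∞, a ^ (1 / 2 : ℝ) * a ^ (1 / 2 : ℝ) = a := fun a ↦ by
    rw [← ENNReal.rpow_add_of_nonneg _ _ (by norm_num) (by norm_num)]; norm_num
  have e2 : ∀ a : ℝ≥0∞, (a ^ (1 / 2 : ℝ)) ^ (2 : ℝ) = a := fun a ↦ by
    rw [← ENNReal.rpow_mul]; norm_num
  simp only [Pi.mul_apply, ← mul_assoc, e1, ENNReal.mul_rpow_of_nonneg _ _ zero_le_two, e2] at h
  calc (∫⁻ x, f x * g x ∂μ) ^ 2
      ≤ ((∫⁻ x, f x ∂μ) ^ (1 / 2 : ℝ) * (∫⁻ x, f x * g x ^ (2 : ℝ) ∂μ) ^ (1 / 2 : ℝ)) ^ 2 := by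
        gcongr
    _ = _ := by
        rw [mul_pow, ← ENNReal.rpow_two, ← ENNReal.rpow_two, e2, e2]
        simp

/-- The Fourier transform of a product, as an integral against the inverse Fourier transform of the
first factor. -/
theorem fourier_schwartz_mul (X : SchwartzMap (Rd d) ℂ) {f : Rd d → ℂ} (hf : Integrable f)
    (ξ : Rd d) :
    𝓕 (fun x ↦ X x * f x) ξ =
      ∫ η, (𝓕⁻ X : SchwartzMap (Rd d) ℂ) η * 𝓕 f (ξ + η) := by
  set Y : SchwartzMap (Rd d) ℂ := 𝓕⁻ X with hY
  have hX : 𝓕 (Y : Rd d → ℂ) = X := by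
    rw [← SchwartzMap.fourier_coe, hY, FourierTransform.fourier_fourierInv_eq]
  -- Modulating `f` by the character of frequency `ξ` translates its transform by `ξ`; the
  -- multiplication formula for `Y` and `h` is then the claim.
  set h : Rd d → ℂ := fun x ↦ Real.fourierChar (-inner ℝ x ξ) • f x with hh
  have hint : Integrable h := (Real.fourierIntegral_convergent_iff ξ).2 hf
  have hF : ∀ η, 𝓕 h η = 𝓕 f (ξ + η) := by
    intro η
    rw [Real.fourier_eq, Real.fourier_eq]
    congr 1
    ext x
    rw [hh]
    simp only [smul_smul, inner_add_right, neg_add, AddChar.map_add_eq_mul]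
    rw [mul_comm]
  have h4 : ∫ x, (𝓕 (Y : Rd d → ℂ)) x • h x = ∫ η, Y η • (𝓕 h) η :=
    VectorFourier.integral_fourierIntegral_smul_eq_flip (L := innerₗ (Rd d))
      Real.continuous_fourierChar continuous_inner Y.integrable hint |>.trans <| by
        rw [flip_innerₗ]; rfl
  rw [hX] at h4
  simp only [hF, smul_eq_mul] at h4
  rw [← h4, Real.fourier_eq]
  congr 1
  ext x
  simp only [hh, Circle.smul_def, smul_eq_mul]
  ring

/-- Multiplication by a Schwartz function is bounded in `H^t(ℝᵈ)` for `0 ≤ t ≤ 1`. -/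
theorem exists_energy_mul_le (X : SchwartzMap (Rd d) ℂ) :
    ∃ C : ℝ≥0, ∀ t : ℝ, 0 ≤ t → t ≤ 1 → ∀ f : Rd d → ℂ, Integrable f →
      energy (sobolevWeight t) (fun x ↦ X x * f x) ≤ C * energy (sobolevWeight t) f := by
  set Y : SchwartzMap (Rd d) ℂ := 𝓕⁻ X with hY
  set A : ℝ≥0∞ := ∫⁻ η, ‖Y η‖ₑ
  -- The kernel `|Y|` times the Peetre factor. Once Cauchy–Schwarz is applied with weight `|Y|`, the
  -- bound is a convolution-type integral with kernel `p`, and Tonelli gives `∫ p` as a factor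
  -- independent of `t`.
  set p : Rd d → ℝ≥0∞ := fun η ↦ ENNReal.ofReal (5 * (1 + 2 * Real.pi * ‖η‖) ^ 2) * ‖Y η‖ₑ
    with hp
  have hA : A ≠ ∞ := Y.integrable.2.ne
  have hB : ∫⁻ η, p η ≠ ∞ := by
    have h0 := Y.integrable_pow_mul volume 0
    have h1 := Y.integrable_pow_mul volume 1
    have h2 := Y.integrable_pow_mul volume 2
    have h3 : Integrable fun η ↦ 5 * (1 + 2 * Real.pi * ‖η‖) ^ 2 * ‖Y η‖ := by
      refine (((h0.const_mul 5).add (h1.const_mul (20 * Real.pi))).add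
        (h2.const_mul (20 * Real.pi ^ 2))).congr (.of_forall fun η ↦ ?_)
      simp only [Pi.add_apply]
      ring
    have h4 := h3.2.ne
    refine ne_of_eq_of_ne ?_ h4
    apply lintegral_congr
    intro η
    rw [enorm_mul, enorm_norm, Real.enorm_of_nonneg (by positivity)]
  refine ⟨(A * ∫⁻ η, p η).toNNReal, fun t ht₀ ht₁ f hf ↦ ?_⟩
  rw [ENNReal.coe_toNNReal (ENNReal.mul_ne_top hA hB)]
  set e : Rd d → ℝ≥0∞ := fun ξ ↦ ENNReal.ofReal (sobolevWeight t ξ) * ‖𝓕 f ξ‖ₑ ^ 2 with he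
  have hwc : Continuous (sobolevWeight (d := d) t) := continuous_sobolevWeight ht₀
  have hFc : Continuous (𝓕 f) := continuous_fourier hf
  have hem : Measurable e := by
    have := hwc.measurable
    have := hFc.measurable
    fun_prop
  have hpm : Measurable p := by
    have := Y.continuous.measurable
    fun_prop
  have hpt : ∀ ξ, ENNReal.ofReal (sobolevWeight t ξ) * ‖𝓕 (fun x ↦ X x * f x) ξ‖ₑ ^ 2 ≤
      A * ∫⁻ η, p η * e (ξ + η) := by
    intro ξ
    have h1 : ‖𝓕 (fun x ↦ X x * f x) ξ‖ₑ ≤ ∫⁻ η, ‖Y η‖ₑ * ‖𝓕 f (ξ + η)‖ₑ := by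
      rw [fourier_schwartz_mul X hf]
      refine (enorm_integral_le_lintegral_enorm _).trans_eq ?_
      simp only [enorm_mul, ← hY]
    have h2 : ‖𝓕 (fun x ↦ X x * f x) ξ‖ₑ ^ 2 ≤ A * ∫⁻ η, ‖Y η‖ₑ * ‖𝓕 f (ξ + η)‖ₑ ^ 2 := by
      refine (pow_le_pow_left' h1 2).trans (sq_lintegral_mul_le ?_ ?_)
      · exact Y.continuous.enorm.aemeasurable
      · exact (by fun_prop : Continuous fun η ↦ ‖𝓕 f (ξ + η)‖ₑ).aemeasurable
    calc _ ≤ ENNReal.ofReal (sobolevWeight t ξ) * (A * ∫⁻ η, ‖Y η‖ₑ * ‖𝓕 f (ξ + η)‖ₑ ^ 2) := by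
          gcongr
      _ = A * ∫⁻ η, ENNReal.ofReal (sobolevWeight t ξ) * (‖Y η‖ₑ * ‖𝓕 f (ξ + η)‖ₑ ^ 2) := by
          rw [lintegral_const_mul' _ _ ENNReal.ofReal_ne_top]
          ring
      _ ≤ A * ∫⁻ η, p η * e (ξ + η) := by
          refine mul_le_mul' le_rfl (lintegral_mono fun η ↦ ?_)
          calc _ ≤ ENNReal.ofReal (5 * (1 + 2 * Real.pi * ‖η‖) ^ 2 * sobolevWeight t (ξ + η)) *
                (‖Y η‖ₑ * ‖𝓕 f (ξ + η)‖ₑ ^ 2) := by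
                gcongr
                exact sobolevWeight_le_mul ht₀ ht₁ ξ η
            _ = p η * e (ξ + η) := by
                rw [ENNReal.ofReal_mul (by positivity)]
                simp only [hp, he]
                ring
  calc energy (sobolevWeight t) (fun x ↦ X x * f x)
      ≤ ∫⁻ ξ, A * ∫⁻ η, p η * e (ξ + η) := lintegral_mono hpt
    _ = A * ∫⁻ ξ, ∫⁻ η, p η * e (ξ + η) := lintegral_const_mul' _ _ hA
    _ = A * ∫⁻ η, ∫⁻ ξ, p η * e (ξ + η) := by
        rw [lintegral_lintegral_swap]
        exact (by fun_prop : Measurable fun z : Rd d × Rd d ↦ p z.2 * e (z.1 + z.2)).aemeasurable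
    _ = A * ∫⁻ η, p η * energy (sobolevWeight t) f := by
        congr 2
        ext η
        rw [lintegral_const_mul _ (by fun_prop), lintegral_add_right_eq_self e η, energy]
    _ = (A * ∫⁻ η, p η) * energy (sobolevWeight t) f := by
        rw [lintegral_mul_const _ hpm, mul_assoc]

/-! ### Shifting the closure of a Lipschitz domain inwards -/

/-- Near every point of the closure of a Lipschitz domain, all translates by small multiples of
the vectors in some ball lead into the domain. -/
theorem HasLipschitzBoundary.exists_shift {Ω : Set (Rd d)} (hΩ : IsOpen Ω)
    (h : HasLipschitzBoundary Ω) {x₀ : Rd d} (hx₀ : x₀ ∈ closure Ω) :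
    ∃ ρ > 0, ∃ (c : Rd d) (r : ℝ), 0 < r ∧ ∀ z ∈ closure Ω ∩ Metric.ball x₀ ρ,
      ∀ y ∈ Metric.closedBall c r, ∀ s : ℝ, 0 < s → s ≤ 1 → z + s • y ∈ Ω := by
  by_cases hx : x₀ ∈ Ω
  · obtain ⟨ρ, hρ, hball⟩ := Metric.isOpen_iff.1 hΩ x₀ hx
    refine ⟨ρ / 2, by positivity, 0, ρ / 2, by positivity, fun z hz y hy s hs hs1 ↦ hball ?_⟩
    have h1 := mem_ball_iff_norm.1 hz.2
    have h2 : ‖y‖ ≤ ρ / 2 := by simpa using hy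
    rw [mem_ball_iff_norm]
    calc ‖z + s • y - x₀‖ = ‖(z - x₀) + s • y‖ := by congr 1; abel
      _ ≤ ‖z - x₀‖ + ‖s • y‖ := norm_add_le _ _
      _ = ‖z - x₀‖ + s * ‖y‖ := by rw [norm_smul, Real.norm_of_nonneg hs.le]
      _ < ρ := by nlinarith [norm_nonneg y]
  obtain ⟨e, γ, K, U, he, hγ, hγe, hU, hxU, hΩU⟩ := h x₀ ⟨hx₀, by rwa [hΩ.interior_eq]⟩
  obtain ⟨ρ, hρ, hball⟩ := Metric.isOpen_iff.1 hU x₀ hxU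
  -- Shifts have length at most `2δ = ρ / 2`, so points within `ρ / 2` of `x₀` stay in the ball of
  -- radius `ρ`.
  set δ : ℝ := ρ / 4 with hδ
  have hδ0 : 0 < δ := by positivity
  -- A perturbation `q` of size `r` can raise `γ` by `K r` and lower the height by `r`. The total
  -- `(K + 1) r` is half of the gain `δ`.
  set r : ℝ := δ / (2 * (K + 1)) with hr
  have hr0 : 0 < r := by positivity
  have hKr : (K + 1) * r = δ / 2 := by rw [hr]; field_simp
  have hrδ : r ≤ δ := by nlinarith [K.coe_nonneg]
  refine ⟨ρ / 2, by positivity, δ • e, r, hr0, fun z hz y hy s hs hs1 ↦ ?_⟩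
  set q : Rd d := y - δ • e with hq
  have hq' : ‖q‖ ≤ r := mem_closedBall_iff_norm.1 hy
  have hy' : y = δ • e + q := by rw [hq]; abel
  have hyn : ‖y‖ ≤ 2 * δ := by
    calc ‖y‖ ≤ ‖δ • e‖ + ‖q‖ := by rw [hy']; exact norm_add_le _ _
      _ ≤ δ + δ := by
        rw [norm_smul, he, mul_one, Real.norm_of_nonneg hδ0.le]; gcongr; linarith
      _ = 2 * δ := by ring
  have hzx := mem_ball_iff_norm.1 hz.2
  have hzU : z ∈ U := hball <| mem_ball_iff_norm.2 (by linarith)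
  have hzyU : z + s • y ∈ U := by
    apply hball
    rw [mem_ball_iff_norm]
    calc ‖z + s • y - x₀‖ = ‖(z - x₀) + s • y‖ := by congr 1; abel
      _ ≤ ‖z - x₀‖ + ‖s • y‖ := norm_add_le _ _
      _ = ‖z - x₀‖ + s * ‖y‖ := by rw [norm_smul, Real.norm_of_nonneg hs.le]
      _ < ρ := by nlinarith [norm_nonneg y]
  -- On the closure only the weak inequality survives; the shift makes it strict again.
  have hzγ : γ z ≤ inner ℝ e z := by
    have hz1 : z ∈ closure (Ω ∩ U) := IsOpen.closure_inter hU ⟨hz.1, hzU⟩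
    have hcl : IsClosed {x | γ x ≤ inner ℝ e x} :=
      isClosed_le hγ.continuous (by fun_prop)
    exact closure_minimal (fun x hx ↦ by rw [hΩU] at hx; exact hx.2.le) hcl hz1
  have hmem : z + s • y ∈ {x | x ∈ U ∧ γ x < inner ℝ e x} := by
    refine ⟨hzyU, ?_⟩
    have h1 : γ (z + s • y) = γ (z + s • q) := by
      rw [← hγe (z + s • q) (s * δ), hy']
      congr 1
      module
    have h2 : γ (z + s • q) ≤ γ z + K * (s * r) := by
      have h3 := hγ.dist_le_mul (z + s • q) z
      rw [Real.dist_eq, dist_eq_norm, add_sub_cancel_left, norm_smul,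
        Real.norm_of_nonneg hs.le] at h3
      have h4 : (K : ℝ) * (s * ‖q‖) ≤ K * (s * r) := by gcongr
      linarith [le_abs_self (γ (z + s • q) - γ z)]
    have h5 : inner ℝ e (z + s • y) = inner ℝ e z + s * δ + s * inner ℝ e q := by
      rw [hy', inner_add_right, inner_smul_right, inner_add_right, inner_smul_right,
        real_inner_self_eq_norm_sq, he]
      ring
    have h6 : -r ≤ inner ℝ e q := by
      have := abs_real_inner_le_norm e q
      rw [he, one_mul] at this
      linarith [neg_abs_le (inner ℝ e q : ℝ)]
    rw [h1, h5]
    have h7 : s * -r ≤ s * inner ℝ e q := by gcongr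
    have h8 : s * ((K + 1) * r) < s * δ := by
      rw [hKr]
      gcongr
      linarith
    nlinarith
  rw [← hΩU] at hmem
  exact hmem.1

/-- A finite smooth partition of unity on the closure of `Ω`, together with mollifiers that shift
the parts of `closure Ω` in the supports of the cutoff functions into `Ω`. -/
structure ShiftCover (Ω : Set (Rd d)) where
  /-- The index set. -/
  ι : Type
  /-- The index set is finite. -/
  fin : Fintype ι
  /-- The cutoff functions. -/
  χ : ι → Rd d → ℝ
  /-- The mollifiers. -/
  η : ι → Rd d → ℝ
  contDiff_χ : ∀ i, ContDiff ℝ (⊤ : ℕ∞) (χ i)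
  compact_χ : ∀ i, HasCompactSupport (χ i)
  contDiff_η : ∀ i, ContDiff ℝ (⊤ : ℕ∞) (η i)
  compact_η : ∀ i, HasCompactSupport (η i)
  integral_η : ∀ i, ∫ x, η i x = 1
  sum_χ : ∀ x ∈ closure Ω, ∑ i, χ i x = 1
  shift : ∀ i, ∀ z ∈ closure Ω ∩ tsupport (χ i), ∀ y ∈ tsupport (η i), ∀ s : ℝ, 0 < s → s ≤ 1 →
    z + s • y ∈ Ω

attribute [instance] ShiftCover.fin

/-- By compactness finitely many of the balls from `exists_shift` cover the closure. The cutoffs are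
subordinate to these balls, and each mollifier is a normalized bump on the associated ball of
admissible shifts. -/
theorem HasLipschitzBoundary.nonempty_shiftCover {Ω : Set (Rd d)} (hΩ : IsOpen Ω)
    (hb : Bornology.IsBounded Ω) (h : HasLipschitzBoundary Ω) : Nonempty (ShiftCover Ω) := by
  have hc : IsCompact (closure Ω) := hb.isCompact_closure
  choose! ρ hρ c r hr hshift using fun (x₀ : Rd d) (hx₀ : x₀ ∈ closure Ω) ↦ h.exists_shift hΩ hx₀
  obtain ⟨T, hT, hcov⟩ := hc.elim_nhds_subcover (fun x ↦ Metric.ball x (ρ x))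
    fun x hx ↦ Metric.ball_mem_nhds x (hρ x hx)
  obtain ⟨n, ⟨eqv⟩⟩ : ∃ n, Nonempty (Fin n ≃ T) := ⟨_, ⟨T.equivFin.symm⟩⟩
  obtain ⟨f, hf⟩ := SmoothPartitionOfUnity.exists_isSubordinate (modelWithCornersSelf ℝ (Rd d))
    (s := closure Ω) isClosed_closure (ι := Fin n)
    (fun i ↦ Metric.ball (eqv i : Rd d) (ρ (eqv i))) (fun i ↦ Metric.isOpen_ball) (by
      intro x hx
      obtain ⟨y, hy, hxy⟩ := mem_iUnion₂.1 (hcov hx)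
      refine mem_iUnion.2 ⟨eqv.symm ⟨y, hy⟩, ?_⟩
      simpa using hxy)
  have hmem : ∀ i, (eqv i : Rd d) ∈ closure Ω := fun i ↦ hT _ (eqv i).2
  let b : ∀ i : Fin n, ContDiffBump (c (eqv i)) := fun i ↦
    ⟨r (eqv i) / 2, r (eqv i), by have := hr _ (hmem i); positivity, by
      have := hr _ (hmem i); linarith⟩
  refine ⟨⟨Fin n, inferInstance, fun i ↦ f i, fun i ↦ (b i).normed volume, ?_, ?_, ?_, ?_, ?_, ?_,
    ?_⟩⟩
  · intro i
    exact (f i).contMDiff.contDiff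
  · intro i
    exact HasCompactSupport.of_support_subset_isCompact
      (isCompact_closedBall (eqv i : Rd d) (ρ (eqv i)))
      ((subset_tsupport _).trans ((hf i).trans Metric.ball_subset_closedBall))
  · exact fun i ↦ (b i).contDiff_normed
  · exact fun i ↦ (b i).hasCompactSupport_normed
  · exact fun i ↦ (b i).integral_normed
  · intro x hx
    rw [← f.sum_eq_one hx, finsum_eq_sum_of_fintype]
  · intro i z hz y hy s hs hs1
    rw [(b i).tsupport_normed_eq] at hy
    exact hshift _ (hmem i) z ⟨hz.1, hf i hz.2⟩ y hy s hs hs1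

/-! ### Dyadic sums and Fourier multipliers -/

/-- The terms grow like `2ⁿ` while `2ⁿ ≤ l` and decay like `2⁻ⁿ` afterwards, so the sum is of the
order of its peak, `l`. -/
theorem sum_two_pow_mul_sq_le {A l : ℝ} (hA : 0 ≤ A) (hl : 0 ≤ l) {u : ℕ → ℝ}
    (hu : ∀ n, 0 ≤ u n) (h1 : ∀ n, u n ≤ A) (h2 : ∀ n, u n ≤ A * (l / 2 ^ n)) (N : ℕ) :
    ∑ n ∈ Finset.range N, 2 ^ n * u n ^ 2 ≤ 6 * A ^ 2 * l := by
  -- With `x = l / 2ⁿ`, the difference `g n - g (n + 1)` is `x / ((1 + x)(2 + x))`, which has the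
  -- same growth and decay, so the sum telescopes. Expanding `(1 + x)(2 + x) = 2 + 3x + x²` and
  -- bounding each term by a multiple of `A² x²` gives `6 = 2 + 3 + 1`.
  set g : ℕ → ℝ := fun n ↦ (l / 2 ^ n) / (1 + l / 2 ^ n) with hg
  have hstep : ∀ n, 2 ^ n * u n ^ 2 ≤ 6 * A ^ 2 * l * (g n - g (n + 1)) := by
    intro n
    have hx : 0 ≤ l / 2 ^ n := by positivity
    have hx2 : l / 2 ^ (n + 1) = (l / 2 ^ n) / 2 := by rw [pow_succ]; field_simp
    have hlx : l = 2 ^ n * (l / 2 ^ n) := by field_simp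
    simp only [hg, hx2]
    have h1' := h1 n
    have h2' := h2 n
    have h0 := hu n
    generalize u n = a at *
    generalize l / 2 ^ n = x at *
    rw [hlx]
    have h3 : x / (1 + x) - x / 2 / (1 + x / 2) = x / ((1 + x) * (2 + x)) := by
      field_simp
      ring
    rw [h3, mul_assoc, mul_assoc, mul_left_comm (A ^ 2), mul_left_comm 6]
    have h5 : a ^ 2 ≤ A ^ 2 := by gcongr
    have h6 : a ^ 2 ≤ A ^ 2 * x ^ 2 := by rw [← mul_pow]; gcongr
    have h7 : a ^ 2 ≤ A ^ 2 * x := by nlinarith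
    rw [mul_assoc (2 ^ n)]
    gcongr
    rw [← mul_assoc, ← mul_assoc, ← mul_div_assoc, le_div_iff₀ (by positivity)]
    have h8 : a ^ 2 * x ≤ A ^ 2 * x * x := by gcongr
    have h9 : a ^ 2 * x ^ 2 ≤ A ^ 2 * x ^ 2 := by gcongr
    nlinarith
  calc _ ≤ ∑ n ∈ Finset.range N, 6 * A ^ 2 * l * (g n - g (n + 1)) :=
        Finset.sum_le_sum fun n _ ↦ hstep n
    _ = 6 * A ^ 2 * l * (g 0 - g N) := by rw [← Finset.mul_sum, Finset.sum_range_sub']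
    _ ≤ 6 * A ^ 2 * l * 1 := by
        gcongr
        have h0 : g 0 ≤ 1 := by
          simp only [hg, pow_zero, div_one]
          rw [div_le_one (by positivity)]
          linarith
        have hN : 0 ≤ g N := by positivity
        linarith
    _ = _ := mul_one _

/-- Bounds of a Schwartz function that serves as a Fourier multiplier. -/
theorem SchwartzMap.exists_multiplier_bound (m : SchwartzMap (Rd d) ℂ) :
    ∃ A : ℝ, 0 ≤ A ∧ (∀ ξ, ‖m ξ‖ ≤ A) ∧ (∀ ξ, ‖ξ‖ * ‖m ξ‖ ≤ A) ∧
      ∀ ξ η, ‖m ξ - m η‖ ≤ A * ‖ξ - η‖ := by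
  set a := SchwartzMap.seminorm ℝ 0 0 m
  set b := SchwartzMap.seminorm ℝ 1 0 m
  set c := SchwartzMap.seminorm ℝ 0 0 (SchwartzMap.fderivCLM ℝ (Rd d) ℂ m)
  have ha : 0 ≤ a := apply_nonneg _ _
  have hb : 0 ≤ b := apply_nonneg _ _
  have hc : 0 ≤ c := apply_nonneg _ _
  refine ⟨a + b + c, by positivity, fun ξ ↦ ?_, fun ξ ↦ ?_, fun ξ η ↦ ?_⟩
  · linarith [SchwartzMap.norm_le_seminorm ℝ m ξ]
  · have := SchwartzMap.norm_pow_mul_le_seminorm ℝ m 1 ξ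
    rw [pow_one] at this
    linarith
  · have h : ‖m ξ - m η‖ ≤ c * ‖ξ - η‖ :=
      Convex.norm_image_sub_le_of_norm_fderiv_le (𝕜 := ℝ) (s := univ)
        (fun x _ ↦ m.differentiableAt)
        (fun x _ ↦ SchwartzMap.norm_le_seminorm ℝ (SchwartzMap.fderivCLM ℝ (Rd d) ℂ m) x)
        convex_univ (mem_univ _) (mem_univ _)
    refine h.trans ?_
    gcongr
    linarith

theorem enorm_sum_sq_le {ι : Type*} [Fintype ι] (f : ι → ℂ) :
    ‖∑ i, f i‖ₑ ^ 2 ≤ Fintype.card ι * ∑ i, ‖f i‖ₑ ^ 2 := by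
  have h1 : ‖∑ i, f i‖ ^ 2 ≤ Fintype.card ι * ∑ i, ‖f i‖ ^ 2 :=
    (pow_le_pow_left₀ (norm_nonneg _) (norm_sum_le _ _) 2).trans
      (by simpa using sq_sum_le_card_mul_sum_sq (s := Finset.univ) (f := fun i ↦ ‖f i‖))
  have h2 := ENNReal.ofReal_le_ofReal h1
  rw [ENNReal.ofReal_mul (by positivity), ENNReal.ofReal_sum_of_nonneg (fun i _ ↦ by positivity),
    ENNReal.ofReal_natCast, ENNReal.ofReal_pow (norm_nonneg _), ofReal_norm] at h2
  simpa only [ENNReal.ofReal_pow (norm_nonneg _), ofReal_norm] using h2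

/-- A square function estimate for sums of Fourier multipliers. -/
theorem sum_lintegral_multiplier_le {ι : Type*} [Fintype ι] {w : Rd d → ℝ}
    {a : ℕ → ι → Rd d → ℂ} {c : ℕ → ℝ≥0} {F : ι → Rd d → ℂ} {K : ℝ≥0} {N : ℕ}
    (ha : ∀ n i, Continuous (a n i)) (hF : ∀ i, Continuous (F i))
    (h : ∀ i ξ, ∑ n ∈ Finset.range N, c n * ‖a n i ξ‖ ^ 2 ≤ K * w ξ) :
    ∑ n ∈ Finset.range N, (c n : ℝ≥0∞) * ∫⁻ ξ, ‖∑ i, a n i ξ * F i ξ‖ₑ ^ 2 ≤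
      Fintype.card ι * K * ∑ i, ∫⁻ ξ, ENNReal.ofReal (w ξ) * ‖F i ξ‖ₑ ^ 2 := by
  have hm : ∀ n i, Measurable fun ξ ↦ ‖a n i ξ * F i ξ‖ₑ ^ 2 := fun n i ↦ by
    have := (ha n i).measurable
    have := (hF i).measurable
    fun_prop
  calc _ ≤ ∑ n ∈ Finset.range N, (c n : ℝ≥0∞) *
        ∫⁻ ξ, Fintype.card ι * ∑ i, ‖a n i ξ * F i ξ‖ₑ ^ 2 := by
        refine Finset.sum_le_sum fun n _ ↦ mul_le_mul' le_rfl (lintegral_mono fun ξ ↦ ?_)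
        exact enorm_sum_sq_le _
    _ = ∑ n ∈ Finset.range N, ∑ i, Fintype.card ι *
          ∫⁻ ξ, (c n : ℝ≥0∞) * ‖a n i ξ * F i ξ‖ₑ ^ 2 := by
        refine Finset.sum_congr rfl fun n _ ↦ ?_
        rw [lintegral_const_mul' _ _ (ENNReal.natCast_ne_top _),
          lintegral_finsetSum _ fun i _ ↦ hm n i, mul_left_comm, Finset.mul_sum, Finset.mul_sum]
        refine Finset.sum_congr rfl fun i _ ↦ ?_
        rw [lintegral_const_mul' _ _ ENNReal.coe_ne_top]
    _ = Fintype.card ι * ∑ i, ∫⁻ ξ, ∑ n ∈ Finset.range N,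
          (c n : ℝ≥0∞) * ‖a n i ξ * F i ξ‖ₑ ^ 2 := by
        rw [Finset.sum_comm, Finset.mul_sum]
        refine Finset.sum_congr rfl fun i _ ↦ ?_
        rw [lintegral_finsetSum _ fun n _ ↦ (hm n i).const_mul _, Finset.mul_sum]
    _ ≤ Fintype.card ι * ∑ i, ∫⁻ ξ, K * (ENNReal.ofReal (w ξ) * ‖F i ξ‖ₑ ^ 2) := by
        refine mul_le_mul' le_rfl (Finset.sum_le_sum fun i _ ↦ lintegral_mono fun ξ ↦ ?_)
        simp only [enorm_mul, mul_pow, ← mul_assoc]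
        rw [← Finset.sum_mul]
        gcongr
        have h2 := ENNReal.ofReal_le_ofReal (h i ξ)
        rw [ENNReal.ofReal_mul (by positivity), ENNReal.ofReal_sum_of_nonneg
          (fun i _ ↦ by positivity), ENNReal.ofReal_coe_nnreal] at h2
        refine le_trans (le_of_eq ?_) h2
        refine Finset.sum_congr rfl fun n _ ↦ ?_
        rw [ENNReal.ofReal_mul (by positivity), ENNReal.ofReal_coe_nnreal,
          ENNReal.ofReal_pow (norm_nonneg _), ofReal_norm]
    _ = _ := by
        simp only [lintegral_const_mul' _ _ ENNReal.coe_ne_top]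
        rw [← Finset.mul_sum, mul_assoc]

/-! ### Smoothing by test functions -/

/-- A smooth compactly supported real function as a complex-valued Schwartz function. -/
def complexSchwartz (g : Rd d → ℝ) (hg : ContDiff ℝ (⊤ : ℕ∞) g) (hc : HasCompactSupport g) :
    SchwartzMap (Rd d) ℂ :=
  HasCompactSupport.toSchwartzMap (f := fun x ↦ (g x : ℂ))
    (hc.comp_left (g := fun r : ℝ ↦ (r : ℂ)) Complex.ofReal_zero)
    (Complex.ofRealCLM.contDiff.comp hg)

theorem complexSchwartz_apply (g : Rd d → ℝ) (hg : ContDiff ℝ (⊤ : ℕ∞) g)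
    (hc : HasCompactSupport g) (x : Rd d) : complexSchwartz g hg hc x = g x := rfl

/-- The rescaling `2^{nd} η(2ⁿ x)` of a mollifier. -/
def dyadicRescale (η : Rd d → ℝ) (n : ℕ) (x : Rd d) : ℝ := (2 ^ n) ^ d * η ((2 ^ n : ℝ) • x)

theorem contDiff_dyadicRescale {η : Rd d → ℝ} (h : ContDiff ℝ (⊤ : ℕ∞) η) (n : ℕ) :
    ContDiff ℝ (⊤ : ℕ∞) (dyadicRescale η n) :=
  contDiff_const.mul (h.comp (contDiff_const_smul _))

theorem tsupport_dyadicRescale_subset (η : Rd d → ℝ) (n : ℕ) :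
    tsupport (dyadicRescale η n) ⊆ {x | (2 ^ n : ℝ) • x ∈ tsupport η} := by
  apply closure_minimal
  · intro x hx
    exact subset_tsupport _ (right_ne_zero_of_mul hx)
  · exact (isClosed_tsupport η).preimage (continuous_const_smul _)

theorem hasCompactSupport_dyadicRescale {η : Rd d → ℝ} (h : HasCompactSupport η) (n : ℕ) :
    HasCompactSupport (dyadicRescale η n) :=
  (h.comp_smul (c := (2 ^ n : ℝ)) (by positivity)).mul_left

theorem fourier_dyadicRescale (η : Rd d → ℝ) (n : ℕ) (ξ : Rd d) :
    𝓕 (fun x ↦ (dyadicRescale η n x : ℂ)) ξ =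
      𝓕 (fun x ↦ (η x : ℂ)) ((2 ^ n : ℝ)⁻¹ • ξ) := by
  rw [Real.fourier_eq, Real.fourier_eq]
  have h := Measure.integral_comp_smul (volume : Measure (Rd d))
    (fun y ↦ Real.fourierChar (-inner ℝ y ((2 ^ n : ℝ)⁻¹ • ξ)) • (η y : ℂ)) (2 ^ n : ℝ)
  have h1 : ∀ x : Rd d, inner ℝ ((2 ^ n : ℝ) • x) ((2 ^ n : ℝ)⁻¹ • ξ) = inner ℝ x ξ := by
    intro x
    rw [inner_smul_left, inner_smul_right, ← mul_assoc]
    simp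
  simp only [h1, finrank_euclideanSpace_fin] at h
  rw [abs_of_nonneg (by positivity)] at h
  have h2 : (∫ y : Rd d, Real.fourierChar (-inner ℝ y ((2 ^ n : ℝ)⁻¹ • ξ)) • (η y : ℂ)) =
      ((2 ^ n : ℝ) ^ d) • ∫ x : Rd d, Real.fourierChar (-inner ℝ x ξ) •
        ((η ((2 ^ n : ℝ) • x) : ℝ) : ℂ) := by
    rw [h, smul_smul, mul_inv_cancel₀ (by positivity), one_smul]
  rw [h2, ← integral_smul]
  congr 1
  ext x
  simp only [dyadicRescale, Circle.smul_def, Complex.real_smul, smul_eq_mul]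
  push_cast
  ring

theorem zeroExt_sub_ae (Ω : Opens (Rd d)) (v w : L2 Ω) :
    zeroExt Ω (v - w) =ᵐ[volume] zeroExt Ω v - zeroExt Ω w := by
  have h := (ae_restrict_iff' Ω.isOpen.measurableSet).1 (Lp.coeFn_sub v w)
  filter_upwards [h] with x hx
  by_cases hxΩ : x ∈ (Ω : Set (Rd d))
  · have hx' : (v - w : L2 Ω) x = v x - w x := hx hxΩ
    have h1 : ∀ u : L2 Ω, zeroExt Ω u x = (u x : ℂ) := fun u ↦ indicator_of_mem hxΩ _
    rw [Pi.sub_apply, h1, h1, h1, hx', Complex.ofReal_sub]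
  · simp [zeroExt, hxΩ]

theorem fourier_zeroExt_sub {Ω : Opens (Rd d)} (hΩ : Bornology.IsBounded (Ω : Set (Rd d)))
    (v w : L2 Ω) (ξ : Rd d) :
    𝓕 (zeroExt Ω (v - w)) ξ = 𝓕 (zeroExt Ω v) ξ - 𝓕 (zeroExt Ω w) ξ := by
  rw [Real.fourier_congr_ae (zeroExt_sub_ae Ω v w), Real.fourier_eq, Real.fourier_eq,
    Real.fourier_eq, ← integral_sub ((Real.fourierIntegral_convergent_iff ξ).2
      (integrable_zeroExt hΩ v)) ((Real.fourierIntegral_convergent_iff ξ).2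
      (integrable_zeroExt hΩ w))]
  simp only [Pi.sub_apply, smul_sub]

theorem zeroExt_testFunction {Ω : Opens (Rd d)} (φ : 𝓓(Ω, ℝ)) :
    zeroExt Ω ((memLp_testFunction φ).toLp φ) =ᵐ[volume] fun x ↦ (φ x : ℂ) := by
  have h1 := (ae_restrict_iff' Ω.isOpen.measurableSet).1 (memLp_testFunction φ).coeFn_toLp
  filter_upwards [h1] with x h3
  by_cases hx : x ∈ (Ω : Set (Rd d))
  · rw [zeroExt, indicator_of_mem hx, h3 hx]
  · have h5 : φ x = 0 := by
      by_contra h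
      exact hx (φ.tsupport_subset (subset_tsupport _ h))
    rw [zeroExt, indicator_of_notMem hx, h5, Complex.ofReal_zero]

namespace ShiftCover

variable {Ω : Opens (Rd d)} (S : ShiftCover (Ω : Set (Rd d)))

/-- The cutoff functions as Schwartz functions. -/
def cutoff (i : S.ι) : SchwartzMap (Rd d) ℂ :=
  complexSchwartz (S.χ i) (S.contDiff_χ i) (S.compact_χ i)

/-- The Fourier transforms of the mollifiers. -/
def symbol (i : S.ι) : SchwartzMap (Rd d) ℂ :=
  𝓕 (complexSchwartz (S.η i) (S.contDiff_η i) (S.compact_η i))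

theorem symbol_zero (i : S.ι) : S.symbol i 0 = 1 := by
  rw [symbol, SchwartzMap.fourier_coe, Real.fourier_eq]
  simp only [inner_zero_right, neg_zero, AddChar.map_zero_eq_one, one_smul,
    complexSchwartz_apply]
  rw [integral_complex_ofReal, S.integral_η, Complex.ofReal_one]

/-- The localization of a function by a cutoff function. -/
def piece (v : L2 Ω) (i : S.ι) (x : Rd d) : ℝ :=
  (Ω : Set (Rd d)).indicator (fun y ↦ S.χ i y * v y) x

theorem ofReal_piece (v : L2 Ω) (i : S.ι) (x : Rd d) :
    (S.piece v i x : ℂ) = S.cutoff i x * zeroExt Ω v x := by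
  by_cases hx : x ∈ (Ω : Set (Rd d)) <;>
    simp [piece, zeroExt, hx, cutoff, complexSchwartz_apply]

theorem integrable_cutoff_mul (hΩ : Bornology.IsBounded (Ω : Set (Rd d))) (v : L2 Ω) (i : S.ι) :
    Integrable fun x ↦ S.cutoff i x * zeroExt Ω v x :=
  (integrable_zeroExt hΩ v).bdd_mul (c := SchwartzMap.seminorm ℝ 0 0 (S.cutoff i))
    (S.cutoff i).continuous.aestronglyMeasurable
    (.of_forall fun x ↦ SchwartzMap.norm_le_seminorm ℝ _ x)

theorem integrable_piece (hΩ : Bornology.IsBounded (Ω : Set (Rd d))) (v : L2 Ω) (i : S.ι) :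
    Integrable (S.piece v i) := by
  have h := (S.integrable_cutoff_mul hΩ v i).re
  refine h.congr (.of_forall fun x ↦ ?_)
  simp only [← ofReal_piece, RCLike.re_to_complex, Complex.ofReal_re]

theorem fourier_zeroExt (hΩ : Bornology.IsBounded (Ω : Set (Rd d))) (v : L2 Ω) (ξ : Rd d) :
    𝓕 (zeroExt Ω v) ξ = ∑ i, 𝓕 (fun x ↦ S.cutoff i x * zeroExt Ω v x) ξ := by
  simp only [Real.fourier_eq]
  rw [← integral_finsetSum _ fun i _ ↦
    (Real.fourierIntegral_convergent_iff ξ).2 (S.integrable_cutoff_mul hΩ v i)]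
  congr 1
  ext x
  rw [← Finset.smul_sum, ← Finset.sum_mul]
  by_cases hx : x ∈ (Ω : Set (Rd d))
  · have h : ∑ i, S.cutoff i x = 1 := by
      have := S.sum_χ x (subset_closure hx)
      simp only [cutoff, complexSchwartz_apply]
      exact_mod_cast this
    rw [h, one_mul]
  · simp [zeroExt, hx]

/-- The localized mollification of the zero extension of `v`. -/
def smoothFun (v : L2 Ω) (n : ℕ) (x : Rd d) : ℝ :=
  ∑ i, (S.piece v i ⋆[ContinuousLinearMap.mul ℝ ℝ, volume] dyadicRescale (S.η i) n) x

theorem contDiff_smoothFun (hΩ : Bornology.IsBounded (Ω : Set (Rd d))) (v : L2 Ω) (n : ℕ) :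
    ContDiff ℝ (⊤ : ℕ∞) (S.smoothFun v n) :=
  ContDiff.sum fun i _ ↦ (hasCompactSupport_dyadicRescale (S.compact_η i) n).contDiff_convolution_right
    _ (S.integrable_piece hΩ v i).locallyIntegrable (contDiff_dyadicRescale (S.contDiff_η i) n)

/-- The `i`-th convolution lives in the compact set `(closure Ω ∩ supp χᵢ) + 2⁻ⁿ supp ηᵢ`, which the
shift property with `s = 2⁻ⁿ` places inside `Ω`. -/
theorem exists_compact_smoothFun (hΩ : Bornology.IsBounded (Ω : Set (Rd d))) (v : L2 Ω) (n : ℕ) :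
    ∃ K : Set (Rd d), IsCompact K ∧ K ⊆ Ω ∧ Function.support (S.smoothFun v n) ⊆ K := by
  refine ⟨⋃ i, (closure (Ω : Set (Rd d)) ∩ tsupport (S.χ i)) + tsupport (dyadicRescale (S.η i) n),
    isCompact_iUnion fun i ↦ ?_, iUnion_subset fun i ↦ ?_, fun x hx ↦ ?_⟩
  · exact (hΩ.isCompact_closure.inter_right (isClosed_tsupport _)).add
      (hasCompactSupport_dyadicRescale (S.compact_η i) n)
  · rintro _ ⟨z, hz, y, hy, rfl⟩
    have h := S.shift i z hz _ (tsupport_dyadicRescale_subset _ _ hy) ((2 ^ n : ℝ)⁻¹)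
      (by positivity) (inv_le_one_of_one_le₀ (one_le_pow₀ one_le_two))
    rwa [smul_smul, inv_mul_cancel₀ (by positivity), one_smul] at h
  · obtain ⟨i, -, hi⟩ := Finset.exists_ne_zero_of_sum_ne_zero hx
    obtain ⟨z, hz, y, hy, rfl⟩ := support_convolution_subset _ hi
    refine mem_iUnion.2 ⟨i, add_mem_add ⟨?_, ?_⟩ (subset_tsupport _ hy)⟩
    · exact subset_closure (mem_of_indicator_ne_zero hz)
    · refine subset_tsupport _ fun h ↦ hz ?_
      rw [piece, indicator_of_mem (mem_of_indicator_ne_zero hz), h, zero_mul]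

/-- The localized mollification of the zero extension of `v`, a test function in `Ω`. -/
def smooth (hΩ : Bornology.IsBounded (Ω : Set (Rd d))) (v : L2 Ω) (n : ℕ) : 𝓓(Ω, ℝ) where
  toFun := S.smoothFun v n
  contDiff' := S.contDiff_smoothFun hΩ v n
  hasCompactSupport' := by
    obtain ⟨K, hK, -, h⟩ := S.exists_compact_smoothFun hΩ v n
    exact .of_support_subset_isCompact hK h
  tsupport_subset' := by
    obtain ⟨K, hK, hKΩ, h⟩ := S.exists_compact_smoothFun hΩ v n
    exact (closure_minimal h hK.isClosed).trans hKΩ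

/-- On the frequency side smoothing multiplies each localized piece by its dilated symbol, so all
estimates below reduce to pointwise bounds on symbols. -/
theorem fourier_smooth (hΩ : Bornology.IsBounded (Ω : Set (Rd d))) (v : L2 Ω) (n : ℕ)
    (ξ : Rd d) :
    𝓕 (zeroExt Ω ((memLp_testFunction (S.smooth hΩ v n)).toLp _)) ξ =
      ∑ i, S.symbol i ((2 ^ n : ℝ)⁻¹ • ξ) * 𝓕 (fun x ↦ S.cutoff i x * zeroExt Ω v x) ξ := by
  have hη : ∀ i, Integrable fun x ↦ (dyadicRescale (S.η i) n x : ℂ) := fun i ↦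
    (complexSchwartz _ (contDiff_dyadicRescale (S.contDiff_η i) n)
      (hasCompactSupport_dyadicRescale (S.compact_η i) n)).integrable
  have h1 : (fun x ↦ ((S.smooth hΩ v n) x : ℂ)) = fun x ↦ ∑ i,
      ((fun x ↦ S.cutoff i x * zeroExt Ω v x) ⋆[ContinuousLinearMap.mul ℂ ℂ, volume]
        fun x ↦ (dyadicRescale (S.η i) n x : ℂ)) x := by
    ext x
    change ((∑ i, _ : ℝ) : ℂ) = _
    rw [Complex.ofReal_sum]
    refine Finset.sum_congr rfl fun i _ ↦ ?_
    rw [convolution_def, convolution_def, ← integral_complex_ofReal]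
    congr 1
    ext y
    simp only [ContinuousLinearMap.mul_apply', ← ofReal_piece]
    push_cast
    rfl
  rw [Real.fourier_congr_ae (zeroExt_testFunction _), h1, Real.fourier_eq]
  simp only [Finset.smul_sum]
  rw [integral_finsetSum _ fun i _ ↦ (Real.fourierIntegral_convergent_iff ξ).2
    ((S.integrable_cutoff_mul hΩ v i).integrable_convolution _ (hη i))]
  refine Finset.sum_congr rfl fun i _ ↦ ?_
  rw [← Real.fourier_eq, Real.fourier_mul_convolution_eq (S.integrable_cutoff_mul hΩ v i) (hη i),
    fourier_dyadicRescale, mul_comm]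
  rfl

end ShiftCover

/-! ### Convergence of the smoothing and the square function estimate -/

/-- A test function as an element of `L²(Ω)`. -/
def testL2 {Ω : Opens (Rd d)} (φ : 𝓓(Ω, ℝ)) : L2 Ω := (memLp_testFunction φ).toLp φ

namespace ShiftCover

variable {Ω : Opens (Rd d)} (S : ShiftCover (Ω : Set (Rd d)))

/-- The Fourier transform of a localized piece of `v`. -/
def pieceFourier (v : L2 Ω) (i : S.ι) : Rd d → ℂ :=
  𝓕 fun x ↦ S.cutoff i x * zeroExt Ω v x

theorem continuous_pieceFourier (hΩ : Bornology.IsBounded (Ω : Set (Rd d))) (v : L2 Ω) (i : S.ι) :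
    Continuous (S.pieceFourier v i) := continuous_fourier (S.integrable_cutoff_mul hΩ v i)

theorem exists_sum_pieceFourier_le (hΩ : Bornology.IsBounded (Ω : Set (Rd d))) :
    ∃ C : ℝ≥0, ∀ t : ℝ, 0 ≤ t → t ≤ 1 → ∀ v : L2 Ω,
      ∑ i, ∫⁻ ξ, ENNReal.ofReal (sobolevWeight t ξ) * ‖S.pieceFourier v i ξ‖ₑ ^ 2 ≤
        C * energy (sobolevWeight t) (zeroExt Ω v) := by
  choose C hC using fun i ↦ exists_energy_mul_le (S.cutoff i)
  refine ⟨∑ i, C i, fun t ht₀ ht₁ v ↦ ?_⟩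
  rw [ENNReal.ofNNReal_finsetSum, Finset.sum_mul]
  exact Finset.sum_le_sum fun i _ ↦ hC i t ht₀ ht₁ _ (integrable_zeroExt hΩ v)

theorem exists_symbol_bound : ∃ A : ℝ, 0 ≤ A ∧ ∀ i, (∀ ξ, ‖S.symbol i ξ‖ ≤ A) ∧
    (∀ ξ, ‖ξ‖ * ‖S.symbol i ξ‖ ≤ A) ∧
      ∀ ξ η, ‖S.symbol i ξ - S.symbol i η‖ ≤ A * ‖ξ - η‖ := by
  choose A hA h1 h2 h3 using fun i ↦ (S.symbol i).exists_multiplier_bound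
  have h : ∀ i, A i ≤ ∑ j, A j := fun i ↦
    Finset.single_le_sum (fun j _ ↦ hA j) (Finset.mem_univ i)
  refine ⟨∑ i, A i, Finset.sum_nonneg fun i _ ↦ hA i, fun i ↦ ⟨fun ξ ↦ (h1 i ξ).trans (h i),
    fun ξ ↦ (h2 i ξ).trans (h i), fun ξ η ↦ (h3 i ξ η).trans ?_⟩⟩
  gcongr
  exact h i

/-- The error has multipliers `symbol(2⁻ⁿ ξ) - 1`, which are bounded and tend to 0 pointwise because
the mollifiers have integral 1. Dominated convergence applies, as the pieces have finite energy. -/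
theorem tendsto_ofTest_smooth (hΩ : Bornology.IsBounded (Ω : Set (Rd d))) {t : ℝ} (ht₀ : 0 ≤ t)
    (ht₁ : t ≤ 1) (v : TildeH Ω t) :
    Filter.Tendsto (fun n ↦ TildeH.ofTest ht₀ (S.smooth hΩ (TildeH.toL2 v) n)) Filter.atTop
      (nhds v) := by
  obtain ⟨C, hC⟩ := S.exists_sum_pieceFourier_le hΩ
  obtain ⟨A, hA, hAb⟩ := S.exists_symbol_bound
  set w := TildeH.toL2 v with hw
  set e : S.ι → Rd d → ℝ≥0∞ := fun i ξ ↦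
    ENNReal.ofReal (sobolevWeight t ξ) * ‖S.pieceFourier w i ξ‖ₑ ^ 2 with he
  set f : S.ι → ℕ → Rd d → ℝ≥0∞ := fun i n ξ ↦
    ENNReal.ofReal (‖S.symbol i ((2 ^ n : ℝ)⁻¹ • ξ) - 1‖ ^ 2) * e i ξ with hf
  have hem : ∀ i, Measurable (e i) := fun i ↦ by
    have := (continuous_sobolevWeight (d := d) ht₀).measurable
    have := (S.continuous_pieceFourier hΩ w i).measurable
    fun_prop
  have hfm : ∀ i n, Measurable (f i n) := fun i n ↦ by
    have := hem i
    have := (S.symbol i).continuous.measurable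
    fun_prop
  have hefin : ∀ i, ∫⁻ ξ, e i ξ ≠ ∞ := by
    have h1 := hC t ht₀ ht₁ w
    rw [hw, ← TildeH.enorm_sq_eq_energy hΩ v] at h1
    have h2 := (h1.trans_lt (ENNReal.mul_lt_top ENNReal.coe_lt_top ENNReal.ofReal_lt_top)).ne
    intro i
    exact (ENNReal.sum_ne_top.1 h2) i (Finset.mem_univ i)
  have hbound : ∀ n, ENNReal.ofReal
      (‖TildeH.ofTest ht₀ (S.smooth hΩ w n) - v‖ ^ 2) ≤
        Fintype.card S.ι * ∑ i, ∫⁻ ξ, f i n ξ := by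
    intro n
    rw [TildeH.enorm_sq_eq_energy hΩ, map_sub, energy, ← lintegral_finsetSum _ fun i _ ↦ hfm i n,
      ← lintegral_const_mul' _ _ (ENNReal.natCast_ne_top _)]
    apply lintegral_mono
    intro ξ
    have h1 : 𝓕 (zeroExt Ω (TildeH.toL2 (TildeH.ofTest ht₀ (S.smooth hΩ w n)) - w)) ξ =
        ∑ i, (S.symbol i ((2 ^ n : ℝ)⁻¹ • ξ) - 1) * S.pieceFourier w i ξ := by
      rw [fourier_zeroExt_sub hΩ, S.fourier_zeroExt hΩ w]
      have h2 := S.fourier_smooth hΩ w n ξ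
      simp only [sub_mul, one_mul, Finset.sum_sub_distrib]
      exact congrArg (· - _) h2
    calc _ ≤ ENNReal.ofReal (sobolevWeight t ξ) * (Fintype.card S.ι *
          ∑ i, ‖(S.symbol i ((2 ^ n : ℝ)⁻¹ • ξ) - 1) * S.pieceFourier w i ξ‖ₑ ^ 2) := by
          beta_reduce
          rw [← hw, h1]
          exact mul_le_mul' le_rfl (enorm_sum_sq_le _)
      _ = _ := by
          rw [mul_left_comm, Finset.mul_sum]
          congr 2
          ext i
          simp only [hf, he]
          rw [ENNReal.ofReal_pow (norm_nonneg _), ofReal_norm, enorm_mul]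
          ring
  have hlim : Filter.Tendsto (fun n ↦ (Fintype.card S.ι : ℝ≥0∞) * ∑ i, ∫⁻ ξ, f i n ξ) Filter.atTop
      (nhds 0) := by
    have h1 : ∀ i, Filter.Tendsto (fun n ↦ ∫⁻ ξ, f i n ξ) Filter.atTop
        (nhds (∫⁻ _ : Rd d, 0)) := by
      intro i
      refine tendsto_lintegral_of_dominated_convergence
        (fun ξ ↦ ENNReal.ofReal ((A + 1) ^ 2) * e i ξ) (hfm i) (fun n ↦ .of_forall fun ξ ↦ ?_) ?_
        (.of_forall fun ξ ↦ ?_)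
      · refine mul_le_mul' (ENNReal.ofReal_le_ofReal (pow_le_pow_left₀ (norm_nonneg _) ?_ 2)) le_rfl
        calc _ ≤ ‖S.symbol i ((2 ^ n : ℝ)⁻¹ • ξ)‖ + ‖(1 : ℂ)‖ := norm_sub_le _ _
          _ ≤ A + 1 := by rw [norm_one]; gcongr; exact (hAb i).1 _
      · rw [lintegral_const_mul' _ _ ENNReal.ofReal_ne_top]
        exact ENNReal.mul_ne_top ENNReal.ofReal_ne_top (hefin i)
      · have h2 : Filter.Tendsto (fun n : ℕ ↦ (2 ^ n : ℝ)⁻¹ • ξ) Filter.atTop (nhds 0) := by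
          have := (tendsto_inv_atTop_zero.comp
            (tendsto_pow_atTop_atTop_of_one_lt (one_lt_two (α := ℝ)))).smul_const ξ
          simpa using this
        have h3 : Filter.Tendsto (fun n : ℕ ↦ ‖S.symbol i ((2 ^ n : ℝ)⁻¹ • ξ) - 1‖ ^ 2)
            Filter.atTop (nhds 0) := by
          have h4 := (((S.symbol i).continuous.tendsto 0).comp h2).sub_const 1 |>.norm.pow 2
          simpa [symbol_zero] using h4
        have h5 := ENNReal.Tendsto.mul_const (b := e i ξ) (ENNReal.tendsto_ofReal h3) (Or.inr (by
          simp only [he]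
          finiteness))
        rwa [ENNReal.ofReal_zero, zero_mul] at h5
    have h6 := ENNReal.Tendsto.const_mul (a := (Fintype.card S.ι : ℝ≥0∞))
      (tendsto_finsetSum Finset.univ fun i _ ↦ h1 i) (Or.inr (ENNReal.natCast_ne_top _))
    simpa using h6
  have h7 : Filter.Tendsto (fun n ↦ ENNReal.ofReal
      (‖TildeH.ofTest ht₀ (S.smooth hΩ w n) - v‖ ^ 2)) Filter.atTop (nhds 0) :=
    tendsto_of_tendsto_of_tendsto_of_le_of_le tendsto_const_nhds hlim (fun _ ↦ zero_le) hbound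
  have h8 := (ENNReal.tendsto_toReal ENNReal.zero_ne_top).comp h7
  rw [tendsto_iff_norm_sub_tendsto_zero]
  have h9 := (Real.continuous_sqrt.tendsto _).comp h8
  simpa [Function.comp_def, ENNReal.toReal_ofReal, Real.sqrt_sq] using h9

theorem norm_le_sobolevWeight_half (ξ : Rd d) : ‖ξ‖ ≤ sobolevWeight (1 / 2) ξ := by
  rw [sobolevWeight, mul_one_div_cancel two_ne_zero, Real.rpow_one]
  nlinarith [Real.pi_gt_three, norm_nonneg ξ]

/-- All three quantities are energies of multipliers acting on the pieces. The bound is uniform in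
`N` because, at each frequency, the dyadic sum of squared multipliers is `O(|ξ|)`, which the weight
of `H^{1/2}` dominates. -/
theorem exists_squareFunction_le (hΩ : Bornology.IsBounded (Ω : Set (Rd d))) :
    ∃ K : ℝ≥0, ∀ (v : L2 Ω) (N : ℕ),
      ∑ n ∈ Finset.range N, 2 ^ n * energy (fun _ ↦ 1)
        (zeroExt Ω (testL2 (S.smooth hΩ v (n + 1)) - testL2 (S.smooth hΩ v n))) ≤
          K * energy (sobolevWeight (1 / 2)) (zeroExt Ω v) ∧
      ∑ n ∈ Finset.range N, (2 ^ n)⁻¹ * energy (fun ξ ↦ (2 * Real.pi * ‖ξ‖) ^ 2)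
        (zeroExt Ω (testL2 (S.smooth hΩ v n))) ≤
          K * energy (sobolevWeight (1 / 2)) (zeroExt Ω v) ∧
      energy (fun _ ↦ 1) (zeroExt Ω (testL2 (S.smooth hΩ v 0))) ≤
        K * energy (sobolevWeight (1 / 2)) (zeroExt Ω v) := by
  obtain ⟨C, hC⟩ := S.exists_sum_pieceFourier_le hΩ
  obtain ⟨A, hA, hAb⟩ := S.exists_symbol_bound
  -- One constant for both families: the differences of symbols need `2 A ≤ B`, the gradient
  -- multipliers need `2π A`.
  set B : ℝ := 2 * Real.pi * A with hB
  have hB0 : 0 ≤ B := by positivity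
  have hAB : 2 * A ≤ B := by nlinarith [Real.pi_gt_three]
  set K : ℝ≥0 := Real.toNNReal (6 * B ^ 2) with hK
  have hK' : (K : ℝ) = 6 * B ^ 2 := Real.coe_toNNReal _ (by positivity)
  have hsc : ∀ (n : ℕ) (ξ : Rd d), ‖(2 ^ n : ℝ)⁻¹ • ξ‖ = ‖ξ‖ / 2 ^ n := fun n ξ ↦ by
    rw [norm_smul, norm_inv, norm_pow, Real.norm_ofNat, div_eq_inv_mul]
  have hcont : ∀ (n : ℕ) i, Continuous fun ξ : Rd d ↦ S.symbol i ((2 ^ n : ℝ)⁻¹ • ξ) := fun n i ↦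
    (S.symbol i).continuous.comp (continuous_const_smul _)
  have key : ∀ (v : L2 Ω) (N : ℕ) (c : ℕ → ℝ≥0) (a : ℕ → S.ι → Rd d → ℂ),
      (∀ n i, Continuous (a n i)) →
      (∀ i ξ, ∑ n ∈ Finset.range N, c n * ‖a n i ξ‖ ^ 2 ≤ K * sobolevWeight (1 / 2) ξ) →
      ∑ n ∈ Finset.range N, (c n : ℝ≥0∞) * ∫⁻ ξ, ‖∑ i, a n i ξ * S.pieceFourier v i ξ‖ₑ ^ 2 ≤
        (Fintype.card S.ι * K * C : ℝ≥0) * energy (sobolevWeight (1 / 2)) (zeroExt Ω v) := by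
    intro v N c a ha h
    refine (sum_lintegral_multiplier_le ha (S.continuous_pieceFourier hΩ v) h).trans ?_
    push_cast
    rw [mul_assoc _ (C : ℝ≥0∞)]
    exact mul_le_mul' le_rfl (hC _ (by norm_num) (by norm_num) v)
  refine ⟨Fintype.card S.ι * K * C, fun v N ↦ ⟨?_, ?_, ?_⟩⟩
  · refine le_of_eq_of_le ?_ (key v N (fun n ↦ 2 ^ n) (fun n i ξ ↦
      S.symbol i ((2 ^ (n + 1) : ℝ)⁻¹ • ξ) - S.symbol i ((2 ^ n : ℝ)⁻¹ • ξ))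
      (fun n i ↦ (hcont (n + 1) i).sub (hcont n i)) fun i ξ ↦ ?_)
    · refine Finset.sum_congr rfl fun n _ ↦ ?_
      rw [energy]
      push_cast
      congr 2
      ext ξ
      rw [fourier_zeroExt_sub hΩ]
      have h1 := S.fourier_smooth hΩ v (n + 1) ξ
      have h2 := S.fourier_smooth hΩ v n ξ
      rw [testL2, testL2, h1, h2]
      simp only [ENNReal.ofReal_one, one_mul, sub_mul, Finset.sum_sub_distrib, pieceFourier]
    · have h := sum_two_pow_mul_sq_le hB0 (norm_nonneg ξ)
        (u := fun n ↦ ‖S.symbol i ((2 ^ (n + 1) : ℝ)⁻¹ • ξ) - S.symbol i ((2 ^ n : ℝ)⁻¹ • ξ)‖)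
        (fun n ↦ norm_nonneg _) (fun n ↦ ?_) (fun n ↦ ?_) N
      · push_cast
        rw [hK']
        refine h.trans ?_
        gcongr
        exact norm_le_sobolevWeight_half ξ
      · refine (norm_sub_le _ _).trans ?_
        linarith [(hAb i).1 ((2 ^ (n + 1) : ℝ)⁻¹ • ξ), (hAb i).1 ((2 ^ n : ℝ)⁻¹ • ξ)]
      · refine ((hAb i).2.2 _ _).trans ?_
        have h1 : ‖(2 ^ (n + 1) : ℝ)⁻¹ • ξ - (2 ^ n : ℝ)⁻¹ • ξ‖ ≤ 2 * (‖ξ‖ / 2 ^ n) := by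
          refine (norm_sub_le _ _).trans ?_
          rw [hsc, hsc, two_mul]
          gcongr
          · norm_num
          · omega
        calc A * _ ≤ A * (2 * (‖ξ‖ / 2 ^ n)) := by gcongr
          _ = (2 * A) * (‖ξ‖ / 2 ^ n) := by ring
          _ ≤ B * (‖ξ‖ / 2 ^ n) := by gcongr
  -- Since `2⁻ⁿ (2π|ξ|)² = 2ⁿ (2π|ξ| / 2ⁿ)²`, the gradient energies also carry the weight `2ⁿ`. The
  -- decay of the symbol bounds the multiplier at high frequencies, and the factor `|ξ| / 2ⁿ` makes
  -- it small at low ones.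
  · refine le_of_eq_of_le ?_ (key v N (fun n ↦ 2 ^ n) (fun n i ξ ↦
      ((2 * Real.pi * (‖ξ‖ / 2 ^ n) : ℝ) : ℂ) * S.symbol i ((2 ^ n : ℝ)⁻¹ • ξ))
      (fun n i ↦ ?_) fun i ξ ↦ ?_)
    · refine Finset.sum_congr rfl fun n _ ↦ ?_
      rw [energy, ← lintegral_const_mul' _ _ (by simp), ← lintegral_const_mul' _ _ (by finiteness)]
      simp only [ENNReal.coe_pow, ENNReal.coe_ofNat]
      congr 1
      ext ξ
      have h2 := S.fourier_smooth hΩ v n ξ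
      rw [testL2, h2]
      have h3 : ∀ r : ℝ, ‖(r : ℂ)‖ₑ ^ 2 = ENNReal.ofReal (r ^ 2) := fun r ↦ by
        rw [← ofReal_norm, ← ENNReal.ofReal_pow (norm_nonneg _), Complex.norm_real,
          Real.norm_eq_abs, sq_abs]
      have h4 : (2 ^ n : ℝ≥0∞) = ENNReal.ofReal (2 ^ n) := by
        rw [ENNReal.ofReal_pow zero_le_two, ENNReal.ofReal_ofNat]
      simp only [pieceFourier, mul_assoc (Complex.ofReal _)]
      rw [← Finset.mul_sum, enorm_mul, mul_pow (‖((_ : ℝ) : ℂ)‖ₑ), h3, ← mul_assoc, ← mul_assoc, h4,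
        ← ENNReal.ofReal_inv_of_pos (by positivity), ← ENNReal.ofReal_mul (by positivity),
        ← ENNReal.ofReal_mul (by positivity)]
      congr 2
      field_simp
    · exact (Complex.continuous_ofReal.comp (by fun_prop)).mul (hcont n i)
    · have h := sum_two_pow_mul_sq_le hB0 (norm_nonneg ξ)
        (u := fun n ↦ ‖((2 * Real.pi * (‖ξ‖ / 2 ^ n) : ℝ) : ℂ) * S.symbol i ((2 ^ n : ℝ)⁻¹ • ξ)‖)
        (fun n ↦ norm_nonneg _) (fun n ↦ ?_) (fun n ↦ ?_) N
      · push_cast at h ⊢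
        rw [hK']
        refine h.trans ?_
        gcongr
        exact norm_le_sobolevWeight_half ξ
      · rw [norm_mul, Complex.norm_real, Real.norm_of_nonneg (by positivity), ← hsc, mul_assoc, hB]
        gcongr
        exact (hAb i).2.1 _
      · rw [norm_mul, Complex.norm_real, Real.norm_of_nonneg (by positivity), hB,
          mul_right_comm _ A]
        gcongr
        exact (hAb i).1 _
  · have h := key v 1 (fun _ ↦ 1) (fun _ i ξ ↦ S.symbol i ((2 ^ 0 : ℝ)⁻¹ • ξ))
      (fun n i ↦ hcont 0 i) fun i ξ ↦ ?_
    · refine le_of_eq_of_le ?_ h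
      rw [energy]
      simp only [Finset.sum_range_one, ENNReal.coe_one, one_mul]
      congr 1
      ext ξ
      have h2 := S.fourier_smooth hΩ v 0 ξ
      rw [testL2, h2]
      simp only [ENNReal.ofReal_one, one_mul, pieceFourier]
    · simp only [Finset.sum_range_one, NNReal.coe_one, one_mul]
      rw [hK']
      have h1 : 1 ≤ sobolevWeight (1 / 2) ξ := by
        unfold sobolevWeight
        have : 0 ≤ (2 * Real.pi * ‖ξ‖) ^ (2 * (1 / 2 : ℝ)) := by positivity
        linarith
      calc _ ≤ A ^ 2 := by gcongr; exact (hAb i).1 _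
        _ ≤ 6 * B ^ 2 := by nlinarith
        _ ≤ _ := le_mul_of_one_le_right (by positivity) h1

end ShiftCover

/-! ### Antisymmetry of the drift form -/

theorem sum_apply_single_mul (L : Rd d →L[ℝ] ℝ) (v : Rd d) :
    ∑ i, L (EuclideanSpace.single i 1) * v i = L v := by
  conv_rhs => rw [← (EuclideanSpace.basisFun (Fin d) ℝ).sum_repr v, map_sum]
  refine Finset.sum_congr rfl fun i _ ↦ ?_
  simp [mul_comm]

theorem IsC1UpToBoundary.differentiableAt {Ω : Opens (Rd d)} {β : Rd d → Rd d}
    (hβ : IsC1UpToBoundary Ω β) {x : Rd d} (hx : x ∈ Ω) : DifferentiableAt ℝ β x :=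
  (hβ.1.differentiableOn one_ne_zero).differentiableAt (Ω.isOpen.mem_nhds hx)

theorem TestFunction.differentiable' {Ω : Opens (Rd d)} (φ : 𝓓(Ω, ℝ)) : Differentiable ℝ φ :=
  φ.contDiff.differentiable (by simp)

/-- Solenoidality enters the argument only here: it removes the term `φ div β`. -/
theorem divergence_smul {Ω : Opens (Rd d)} {β : Rd d → Rd d} (hβ : IsC1UpToBoundary Ω β)
    (hdiv : IsSolenoidal Ω β) (φ : 𝓓(Ω, ℝ)) {x : Rd d} (hx : x ∈ Ω) :
    divergence (fun y ↦ φ y • β y) x = fderiv ℝ φ x (β x) := by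
  have h0 := hdiv x hx
  rw [divergence] at h0 ⊢
  rw [fderiv_fun_smul φ.differentiable'.differentiableAt (hβ.differentiableAt hx)]
  simp only [add_apply, smul_apply,
    ContinuousLinearMap.smulRight_apply, PiLp.add_apply, PiLp.smul_apply, smul_eq_mul,
    Finset.sum_add_distrib, ← Finset.mul_sum, h0, mul_zero, zero_add]
  exact sum_apply_single_mul _ _

theorem driftDistribution_eq {Ω : Opens (Rd d)} {β : Rd d → Rd d} (hβ : IsC1UpToBoundary Ω β)
    (hdiv : IsSolenoidal Ω β) (v : L2 Ω) (φ : 𝓓(Ω, ℝ)) :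
    driftDistribution Ω β v φ =
      -∫ x in (Ω : Set (Rd d)), v x * fderiv ℝ φ x (β x) := by
  rw [driftDistribution]
  congr 1
  refine setIntegral_congr_fun Ω.isOpen.measurableSet fun x hx ↦ ?_
  simp only [divergence_smul hβ hdiv φ hx]

theorem TestFunction.eq_zero_of_notMem {Ω : Opens (Rd d)} (φ : 𝓓(Ω, ℝ)) {x : Rd d} (hx : x ∉ Ω) :
    φ x = 0 := by
  by_contra h
  exact hx (φ.tsupport_subset (subset_tsupport _ h))

theorem TestFunction.fderiv_eq_zero_of_notMem {Ω : Opens (Rd d)} (φ : 𝓓(Ω, ℝ)) {x : Rd d}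
    (hx : x ∉ Ω) : fderiv ℝ φ x = 0 := by
  by_contra h
  exact hx (φ.tsupport_subset (support_fderiv_subset ℝ h))

/-- Nothing is known of `β` outside `closure Ω`, but the product vanishes near every point outside
its support, which lies in `Ω`. This permits integration by parts over the whole space. -/
theorem contDiff_test_mul_apply {Ω : Opens (Rd d)} {β : Rd d → Rd d} (hβ : IsC1UpToBoundary Ω β)
    (ψ : 𝓓(Ω, ℝ)) (i : Fin d) : ContDiff ℝ 1 fun x ↦ ψ x * β x i := by
  refine contDiff_iff_contDiffAt.2 fun x ↦ ?_
  by_cases hx : x ∈ tsupport fun x ↦ ψ x * β x i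
  swap
  · exact contDiffAt_const.congr_of_eventuallyEq (notMem_tsupport_iff_eventuallyEq.1 hx)
  have hxΩ : x ∈ Ω := ψ.tsupport_subset (closure_mono (fun y hy ↦ left_ne_zero_of_mul hy) hx)
  have h1 : ContDiffAt ℝ 1 β x := hβ.1.contDiffAt (Ω.isOpen.mem_nhds hxΩ)
  exact (ψ.contDiff.of_le (by norm_cast)).contDiffAt.mul
    (contDiffAt_euclidean.1 h1 i)

/-- The drift form is antisymmetric. -/
theorem driftForm_antisymm {Ω : Opens (Rd d)} {β : Rd d → Rd d} (hβ : IsC1UpToBoundary Ω β)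
    (hdiv : IsSolenoidal Ω β) (φ ψ : 𝓓(Ω, ℝ)) :
    driftForm Ω β φ ψ = -driftForm Ω β ψ φ := by
  set g : Fin d → Rd d → ℝ := fun i x ↦ ψ x * β x i with hg
  have hgd : ∀ i, ContDiff ℝ 1 (g i) := contDiff_test_mul_apply hβ ψ
  have hφc : Continuous (fderiv ℝ φ) := φ.contDiff.continuous_fderiv (by simp)
  have hI1 : ∀ i, Integrable fun x ↦ fderiv ℝ φ x (EuclideanSpace.single i 1) * g i x := fun i ↦
    ((hφc.clm_apply continuous_const).mul (hgd i).continuous).integrable_of_hasCompactSupport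
      (φ.hasCompactSupport.fderiv_apply (𝕜 := ℝ) _).mul_right
  have hI2 : ∀ i, Integrable fun x ↦ φ x * fderiv ℝ (g i) x (EuclideanSpace.single i 1) := fun i ↦
    (φ.continuous.mul (((hgd i).continuous_fderiv one_ne_zero).clm_apply
      continuous_const)).integrable_of_hasCompactSupport φ.hasCompactSupport.mul_right
  have hI3 : ∀ i, Integrable fun x ↦ φ x * g i x := fun i ↦
    (φ.continuous.mul (hgd i).continuous).integrable_of_hasCompactSupport
      φ.hasCompactSupport.mul_right
  have hpart : ∀ i, ∫ x, φ x * fderiv ℝ (g i) x (EuclideanSpace.single i 1) =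
      -∫ x, fderiv ℝ φ x (EuclideanSpace.single i 1) * g i x := fun i ↦
    integral_mul_fderiv_eq_neg_fderiv_mul_of_integrable (hI1 i) (hI2 i) (hI3 i)
      (fun x _ ↦ φ.differentiable'.differentiableAt)
      (fun x _ ↦ ((hgd i).differentiable one_ne_zero).differentiableAt)
  have hsum : ∀ x ∈ Ω, ∑ i, fderiv ℝ (g i) x (EuclideanSpace.single i 1) =
      fderiv ℝ ψ x (β x) := by
    intro x hx
    rw [← divergence_smul hβ hdiv ψ hx, divergence]
    refine Finset.sum_congr rfl fun i _ ↦ ?_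
    have h1 : HasFDerivAt (fun y ↦ ψ y • β y) (fderiv ℝ (fun y ↦ ψ y • β y) x) x :=
      (ψ.differentiable'.differentiableAt.fun_smul (hβ.differentiableAt hx)).hasFDerivAt
    have h2 := (EuclideanSpace.proj (𝕜 := ℝ) i).hasFDerivAt.comp x h1
    exact congrArg (· (EuclideanSpace.single i 1)) h2.fderiv
  have hL : driftForm Ω β ψ φ =
      ∫ x, ∑ i, φ x * fderiv ℝ (g i) x (EuclideanSpace.single i 1) := by
    rw [← setIntegral_eq_integral_of_forall_compl_eq_zero (s := (Ω : Set (Rd d))), driftForm]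
    · refine setIntegral_congr_fun Ω.isOpen.measurableSet fun x hx ↦ ?_
      simp only [← Finset.mul_sum, hsum x hx]
      ring
    · intro x hx
      simp [φ.eq_zero_of_notMem hx]
  have hR : driftForm Ω β φ ψ =
      ∫ x, ∑ i, fderiv ℝ φ x (EuclideanSpace.single i 1) * g i x := by
    rw [← setIntegral_eq_integral_of_forall_compl_eq_zero (s := (Ω : Set (Rd d))), driftForm]
    · refine setIntegral_congr_fun Ω.isOpen.measurableSet fun x hx ↦ ?_
      simp only [hg, mul_left_comm _ (ψ x), ← Finset.mul_sum, sum_apply_single_mul]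
      ring
    · intro x hx
      simp [φ.fderiv_eq_zero_of_notMem hx]
  rw [hL, hR, integral_finsetSum _ fun i _ ↦ hI1 i, integral_finsetSum _ fun i _ ↦ hI2 i,
    ← Finset.sum_neg_distrib]
  exact Finset.sum_congr rfl fun i _ ↦ by rw [hpart, neg_neg]

/-! ### Bounds by the `L²` norm and the gradient -/

/-- Continuity on the compact closure makes the essential supremum finite; otherwise `toReal` in
`supNorm` would return 0. -/
theorem IsC1UpToBoundary.ae_enorm_le {Ω : Opens (Rd d)} {β : Rd d → Rd d}
    (hΩ : Bornology.IsBounded (Ω : Set (Rd d))) (hβ : IsC1UpToBoundary Ω β) :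
    ∀ᵐ x ∂volume.restrict (Ω : Set (Rd d)), ‖β x‖ₑ ≤ ENNReal.ofReal (supNorm Ω β) := by
  obtain ⟨M, hM⟩ := hΩ.isCompact_closure.exists_bound_of_continuousOn hβ.2.1
  have hfin : eLpNorm β ∞ (volume.restrict (Ω : Set (Rd d))) ≠ ∞ := by
    refine ((memLp_top_of_bound ((hβ.2.1.mono subset_closure).aestronglyMeasurable
      Ω.isOpen.measurableSet) M ?_).2).ne
    filter_upwards [ae_restrict_mem Ω.isOpen.measurableSet] with x hx using hM x (subset_closure hx)
  rw [supNorm, ENNReal.ofReal_toReal hfin, eLpNorm_exponent_top]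
  exact enorm_ae_le_eLpNormEssSup β _

theorem ENNReal.mul_le_add_sq (c a b : ℝ≥0∞) (h0 : c ≠ 0) (hc : c ≠ ∞) :
    a * b ≤ c * b ^ 2 + c⁻¹ * a ^ 2 := by
  rcases le_total a (c * b) with h | h
  · calc a * b ≤ c * b * b := by gcongr
      _ = c * b ^ 2 := by ring
      _ ≤ _ := le_self_add
  · have h1 : b ≤ c⁻¹ * a := by
      rwa [← ENNReal.div_eq_inv_mul, ENNReal.le_div_iff_mul_le (Or.inl h0) (Or.inl hc), mul_comm]
    calc a * b ≤ a * (c⁻¹ * a) := by gcongr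
      _ = c⁻¹ * a ^ 2 := by ring
      _ ≤ _ := le_add_self

/-- Young's inequality with a free weight `c`, taken to be `2ⁿ` in the dyadic argument. -/
theorem enorm_driftForm_le {Ω : Opens (Rd d)} {β : Rd d → Rd d}
    (hΩ : Bornology.IsBounded (Ω : Set (Rd d))) (hβ : IsC1UpToBoundary Ω β) (φ ψ : 𝓓(Ω, ℝ))
    {c : ℝ≥0∞} (h0 : c ≠ 0) (hc : c ≠ ∞) :
    ‖driftForm Ω β φ ψ‖ₑ ≤ ENNReal.ofReal (supNorm Ω β) *
      (c * (∫⁻ x, ‖ψ x‖ₑ ^ 2) + c⁻¹ * ∫⁻ x, ‖fderiv ℝ φ x‖ₑ ^ 2) := by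
  have hm1 : Measurable fun x ↦ ‖ψ x‖ₑ ^ 2 := ψ.continuous.enorm.measurable.pow_const 2
  calc ‖driftForm Ω β φ ψ‖ₑ
      ≤ ∫⁻ x in (Ω : Set (Rd d)), ‖fderiv ℝ φ x (β x) * ψ x‖ₑ :=
        enorm_integral_le_lintegral_enorm _
    _ ≤ ∫⁻ x in (Ω : Set (Rd d)), ENNReal.ofReal (supNorm Ω β) *
          (c * ‖ψ x‖ₑ ^ 2 + c⁻¹ * ‖fderiv ℝ φ x‖ₑ ^ 2) := by
        apply lintegral_mono_ae
        filter_upwards [hβ.ae_enorm_le hΩ] with x hx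
        rw [enorm_mul]
        calc _ ≤ ‖fderiv ℝ φ x‖ₑ * ENNReal.ofReal (supNorm Ω β) * ‖ψ x‖ₑ := by
              gcongr
              exact (ContinuousLinearMap.le_opENorm _ _).trans (by gcongr)
          _ = ENNReal.ofReal (supNorm Ω β) * (‖fderiv ℝ φ x‖ₑ * ‖ψ x‖ₑ) := by ring
          _ ≤ _ := by
              gcongr
              exact ENNReal.mul_le_add_sq c _ _ h0 hc
    _ ≤ ∫⁻ x, ENNReal.ofReal (supNorm Ω β) *
          (c * ‖ψ x‖ₑ ^ 2 + c⁻¹ * ‖fderiv ℝ φ x‖ₑ ^ 2) := setLIntegral_le_lintegral _ _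
    _ = _ := by
        rw [lintegral_const_mul' _ _ ENNReal.ofReal_ne_top,
          lintegral_add_left (hm1.const_mul c), lintegral_const_mul' _ _ hc,
          lintegral_const_mul' _ _ (ENNReal.inv_ne_top.2 h0)]

theorem opNorm_sq_le_sum (L : Rd d →L[ℝ] ℝ) :
    ‖L‖ ^ 2 ≤ ∑ i, ‖L (EuclideanSpace.single i 1)‖ ^ 2 := by
  have h : ‖L‖ ≤ Real.sqrt (∑ i, ‖L (EuclideanSpace.single i 1)‖ ^ 2) := by
    refine L.opNorm_le_bound (Real.sqrt_nonneg _) fun v ↦ ?_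
    rw [← sum_apply_single_mul, EuclideanSpace.norm_eq]
    calc _ ≤ ∑ i, ‖L (EuclideanSpace.single i 1)‖ * ‖v i‖ := by
          refine (norm_sum_le _ _).trans_eq ?_
          simp only [norm_mul]
      _ ≤ _ := Real.sum_mul_le_sqrt_mul_sqrt _ _ _
  calc _ ≤ Real.sqrt (∑ i, ‖L (EuclideanSpace.single i 1)‖ ^ 2) ^ 2 := by gcongr
    _ = _ := Real.sq_sqrt (Finset.sum_nonneg fun i _ ↦ by positivity)

/-- The operator norm of the derivative is at most its Euclidean norm, and Plancherel applies to
each partial derivative. -/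
theorem lintegral_fderiv_sq_le {Ω : Opens (Rd d)} (φ : 𝓓(Ω, ℝ)) :
    ∫⁻ x, ‖fderiv ℝ φ x‖ₑ ^ 2 ≤
      energy (fun ξ ↦ (2 * Real.pi * ‖ξ‖) ^ 2) fun x ↦ (φ x : ℂ) := by
  set f := testToSchwartz φ with hf
  have hfφ : ∀ x, f x = φ x := fun x ↦ rfl
  let e : Fin d → Rd d := fun i ↦ EuclideanSpace.single i 1
  let D : Fin d → SchwartzMap (Rd d) ℂ := fun i ↦ LineDeriv.lineDerivOp (e i) f
  have hD : ∀ i x, D i x = (fderiv ℝ φ x (e i) : ℝ) := by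
    intro i x
    have h1 := (Complex.ofRealCLM.hasFDerivAt (x := φ x)).comp x
      (φ.differentiable' x).hasFDerivAt
    simp only [D]
    rw [SchwartzMap.lineDerivOp_apply_eq_fderiv]
    exact congrArg (· (e i)) h1.fderiv
  have hDm : ∀ i, Measurable fun x ↦ ‖D i x‖ₑ ^ 2 := fun i ↦
    (D i).continuous.enorm.measurable.pow_const 2
  have h1 : ∫⁻ x, ‖fderiv ℝ φ x‖ₑ ^ 2 ≤ ∑ i, ∫⁻ x, ‖D i x‖ₑ ^ 2 := by
    rw [← lintegral_finsetSum _ fun i _ ↦ hDm i]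
    refine lintegral_mono fun x ↦ ?_
    have h2 := ENNReal.ofReal_le_ofReal (opNorm_sq_le_sum (fderiv ℝ φ x))
    rw [ENNReal.ofReal_sum_of_nonneg fun i _ ↦ by positivity] at h2
    simp only [ENNReal.ofReal_pow (norm_nonneg _), ofReal_norm] at h2
    refine h2.trans_eq (Finset.sum_congr rfl fun i _ ↦ ?_)
    rw [hD, ← ofReal_norm, ← ofReal_norm, Complex.norm_real]
  have h3 : ∀ i, ∫⁻ x, ‖D i x‖ₑ ^ 2 =
      ∫⁻ ξ, ENNReal.ofReal ((2 * Real.pi * ξ i) ^ 2) * ‖𝓕 (f : Rd d → ℂ) ξ‖ₑ ^ 2 := by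
    intro i
    have h4 := energy_one (D i).integrable ((D i).memLp 2)
    have h5 := eLpNorm_nnreal_pow_eq_lintegral (p := 2) (μ := volume) (f := D i) (by norm_num)
    simp only [NNReal.coe_ofNat, ENNReal.coe_ofNat, ENNReal.rpow_ofNat] at h5
    rw [← h5, ← h4, energy]
    refine lintegral_congr fun ξ ↦ ?_
    have h6 : 𝓕 (D i : Rd d → ℂ) ξ = (2 * Real.pi * ξ i : ℝ) * Complex.I * 𝓕 (f : Rd d → ℂ) ξ := by
      rw [← SchwartzMap.fourier_coe, SchwartzMap.fourier_lineDerivOp_eq]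
      rw [smul_apply, SchwartzMap.smulLeftCLM_apply_apply (by fun_prop),
        SchwartzMap.fourier_coe]
      simp [e, EuclideanSpace.inner_single_right]
      ring
    rw [h6, enorm_mul, enorm_mul, mul_pow, mul_pow, ← ofReal_norm, Complex.norm_real,
      ← ENNReal.ofReal_pow (norm_nonneg _), Real.norm_eq_abs, sq_abs, ← ofReal_norm Complex.I]
    simp
  refine h1.trans_eq ?_
  have hFm : Measurable (𝓕 (f : Rd d → ℂ)) := (continuous_fourier f.integrable).measurable
  simp only [h3]
  rw [← lintegral_finsetSum _ fun i _ ↦ by fun_prop, energy]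
  refine lintegral_congr fun ξ ↦ ?_
  rw [← Finset.sum_mul, ← ENNReal.ofReal_sum_of_nonneg fun i _ ↦ by positivity]
  congr 2
  rw [mul_pow, EuclideanSpace.norm_sq_eq, Finset.mul_sum]
  simp only [mul_pow, Real.norm_eq_abs, sq_abs]

/-! ### The drift as an `L²` pairing -/

theorem memLp_drift {Ω : Opens (Rd d)} {β : Rd d → Rd d}
    (hΩ : Bornology.IsBounded (Ω : Set (Rd d))) (hβ : IsC1UpToBoundary Ω β) (φ : 𝓓(Ω, ℝ)) :
    MemLp (fun x ↦ fderiv ℝ φ x (β x)) 2 (volume.restrict (Ω : Set (Rd d))) := by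
  obtain ⟨M, hM⟩ := hΩ.isCompact_closure.exists_bound_of_continuousOn hβ.2.1
  have hφc : Continuous (fderiv ℝ φ) := φ.contDiff.continuous_fderiv (by simp)
  have h1 : MemLp (fderiv ℝ φ) 2 (volume.restrict (Ω : Set (Rd d))) :=
    (hφc.memLp_of_hasCompactSupport (φ.hasCompactSupport.fderiv ℝ)).restrict _
  refine h1.of_le_mul (c := M)
    ((hφc.continuousOn.clm_apply (hβ.2.1.mono subset_closure)).aestronglyMeasurable
      Ω.isOpen.measurableSet) ?_
  filter_upwards [ae_restrict_mem Ω.isOpen.measurableSet] with x hx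
  calc _ ≤ ‖fderiv ℝ φ x‖ * ‖β x‖ := ContinuousLinearMap.le_opNorm _ _
    _ ≤ ‖fderiv ℝ φ x‖ * M := by gcongr; exact hM x (subset_closure hx)
    _ = _ := mul_comm _ _

/-- The function `β · ∇φ` in `L²(Ω)`, for test functions `φ`. -/
def driftL2 {Ω : Opens (Rd d)} {β : Rd d → Rd d}
    (hΩ : Bornology.IsBounded (Ω : Set (Rd d))) (hβ : IsC1UpToBoundary Ω β) :
    𝓓(Ω, ℝ) →ₗ[ℝ] L2 Ω where
  toFun φ := (memLp_drift hΩ hβ φ).toLp _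
  map_add' φ ψ := by
    rw [← MemLp.toLp_add]
    refine MemLp.toLp_congr _ _ (.of_forall fun x ↦ ?_)
    have h : fderiv ℝ (φ + ψ : 𝓓(Ω, ℝ)) x = fderiv ℝ φ x + fderiv ℝ ψ x :=
      fderiv_add (φ.differentiable' x) (ψ.differentiable' x)
    exact congrArg (· (β x)) h
  map_smul' c φ := by
    rw [RingHom.id_apply, ← MemLp.toLp_const_smul]
    refine MemLp.toLp_congr _ _ (.of_forall fun x ↦ ?_)
    have h : fderiv ℝ (c • φ : 𝓓(Ω, ℝ)) x = c • fderiv ℝ φ x :=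
      fderiv_const_smul (φ.differentiable' x) c
    exact congrArg (· (β x)) h

/-- The inclusion of the test functions in `L²(Ω)`. -/
def testL2ₗ (Ω : Opens (Rd d)) : 𝓓(Ω, ℝ) →ₗ[ℝ] L2 Ω where
  toFun := testL2
  map_add' φ ψ := by
    rw [testL2, testL2, testL2, ← MemLp.toLp_add]
    rfl
  map_smul' c φ := by
    rw [RingHom.id_apply, testL2, testL2, ← MemLp.toLp_const_smul]
    rfl

/-- The inclusion of the test functions in `H̃^t(Ω)`. -/
def TildeH.ofTestₗ {t : ℝ} (ht : 0 ≤ t) (Ω : Opens (Rd d)) : 𝓓(Ω, ℝ) →ₗ[ℝ] TildeH Ω t where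
  toFun := TildeH.ofTest ht
  map_add' φ ψ := Subtype.ext ((testL2ₗ Ω).map_add φ ψ)
  map_smul' c φ := Subtype.ext ((testL2ₗ Ω).map_smul c φ)

/-- As an inner product with a fixed `L²` function, the distribution is visibly linear in both
arguments and continuous in `v`. -/
theorem driftDistribution_eq_inner {Ω : Opens (Rd d)} {β : Rd d → Rd d}
    (hΩ : Bornology.IsBounded (Ω : Set (Rd d))) (hβ : IsC1UpToBoundary Ω β)
    (hdiv : IsSolenoidal Ω β) (v : L2 Ω) (φ : 𝓓(Ω, ℝ)) :
    driftDistribution Ω β v φ = -inner ℝ v (driftL2 hΩ hβ φ) := by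
  rw [driftDistribution_eq hβ hdiv, L2.inner_def]
  congr 1
  apply integral_congr_ae
  filter_upwards [(memLp_drift hΩ hβ φ).coeFn_toLp] with x hx
  have h : driftL2 hΩ hβ φ x = fderiv ℝ φ x (β x) := hx
  rw [h]
  simp [mul_comm]

theorem driftForm_eq_inner {Ω : Opens (Rd d)} {β : Rd d → Rd d}
    (hΩ : Bornology.IsBounded (Ω : Set (Rd d))) (hβ : IsC1UpToBoundary Ω β) (φ ψ : 𝓓(Ω, ℝ)) :
    driftForm Ω β φ ψ = inner ℝ (driftL2 hΩ hβ φ) (testL2ₗ Ω ψ) := by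
  rw [driftForm, L2.inner_def]
  apply integral_congr_ae
  filter_upwards [(memLp_drift hΩ hβ φ).coeFn_toLp, (memLp_testFunction ψ).coeFn_toLp]
    with x hx hy
  have h : driftL2 hΩ hβ φ x = fderiv ℝ φ x (β x) := hx
  have h' : testL2ₗ Ω ψ x = ψ x := hy
  rw [h, h']
  simp [mul_comm]

theorem driftDistribution_testL2 {Ω : Opens (Rd d)} {β : Rd d → Rd d}
    (hΩ : Bornology.IsBounded (Ω : Set (Rd d))) (hβ : IsC1UpToBoundary Ω β)
    (hdiv : IsSolenoidal Ω β) (φ ψ : 𝓓(Ω, ℝ)) :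
    driftDistribution Ω β (testL2ₗ Ω φ) ψ = driftForm Ω β φ ψ := by
  rw [driftDistribution_eq_inner hΩ hβ hdiv, driftForm_antisymm hβ hdiv, driftForm_eq_inner hΩ hβ,
    real_inner_comm]

/-! ### Bilinear bounds in `H̃¹` and `H̃^{1/2}` -/

theorem energy_mono {w w' : Rd d → ℝ} (h : ∀ ξ, w ξ ≤ w' ξ) (f : Rd d → ℂ) :
    energy w f ≤ energy w' f :=
  lintegral_mono fun ξ ↦ mul_le_mul' (ENNReal.ofReal_le_ofReal (h ξ)) le_rfl

theorem one_le_sobolevWeight (t : ℝ) (ξ : Rd d) : 1 ≤ sobolevWeight t ξ :=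
  le_add_of_nonneg_right (by positivity)

theorem lintegral_test_sq {Ω : Opens (Rd d)} (φ : 𝓓(Ω, ℝ)) :
    ∫⁻ x, ‖φ x‖ₑ ^ 2 = energy (fun _ ↦ 1) (zeroExt Ω (testL2 φ)) := by
  rw [testL2, energy_congr (zeroExt_testFunction φ)]
  have h := energy_one (f := fun x ↦ (φ x : ℂ)) (testToSchwartz φ).integrable
    ((testToSchwartz φ).memLp 2 volume)
  have h5 := eLpNorm_nnreal_pow_eq_lintegral (p := 2) (μ := volume) (f := fun x ↦ (φ x : ℂ))
    (by norm_num)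
  simp only [NNReal.coe_ofNat, ENNReal.coe_ofNat, ENNReal.rpow_ofNat] at h5
  rw [h, h5]
  refine lintegral_congr fun x ↦ ?_
  rw [← ofReal_norm, ← ofReal_norm, Complex.norm_real]

theorem enorm_driftForm_le_energy {Ω : Opens (Rd d)} {β : Rd d → Rd d}
    (hΩ : Bornology.IsBounded (Ω : Set (Rd d))) (hβ : IsC1UpToBoundary Ω β) (φ ψ : 𝓓(Ω, ℝ))
    {c : ℝ≥0∞} (h0 : c ≠ 0) (hc : c ≠ ∞) :
    ‖driftForm Ω β φ ψ‖ₑ ≤ ENNReal.ofReal (supNorm Ω β) *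
      (c * energy (fun _ ↦ 1) (zeroExt Ω (testL2 ψ)) +
        c⁻¹ * energy (fun ξ ↦ (2 * Real.pi * ‖ξ‖) ^ 2) (zeroExt Ω (testL2 φ))) := by
  refine (enorm_driftForm_le hΩ hβ φ ψ h0 hc).trans ?_
  rw [lintegral_test_sq]
  gcongr
  rw [testL2, energy_congr (zeroExt_testFunction φ)]
  exact lintegral_fderiv_sq_le φ

theorem supNorm_nonneg (Ω : Opens (Rd d)) (β : Rd d → Rd d) : 0 ≤ supNorm Ω β :=
  ENNReal.toReal_nonneg

/-- A quadratic bound of a bihomogeneous form implies a bilinear one. -/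
theorem abs_le_mul_norm_of_abs_le_add_sq {V E : Type*} [AddCommGroup V] [Module ℝ V]
    [NormedAddCommGroup E] [NormedSpace ℝ E] (B : V →ₗ[ℝ] V →ₗ[ℝ] ℝ) (e : V →ₗ[ℝ] E) {M : ℝ} (hM : 0 ≤ M)
    (h : ∀ v w, |B v w| ≤ M * (‖e v‖ ^ 2 + ‖e w‖ ^ 2)) (v w : V) :
    |B v w| ≤ 2 * M * ‖e v‖ * ‖e w‖ := by
  have key : ∀ s : ℝ, 0 < s → |B v w| ≤ M * (s ^ 2 * ‖e v‖ ^ 2 + s⁻¹ ^ 2 * ‖e w‖ ^ 2) := by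
    intro s hs
    have h1 := h (s • v) (s⁻¹ • w)
    simp only [map_smul, LinearMap.smul_apply, norm_smul, smul_eq_mul, mul_pow, norm_inv,
      Real.norm_of_nonneg hs.le] at h1
    rwa [inv_mul_cancel_left₀ hs.ne'] at h1
  set a := ‖e v‖
  set b := ‖e w‖
  have ha : 0 ≤ a := norm_nonneg _
  have hb : 0 ≤ b := norm_nonneg _
  have key2 : ∀ ε : ℝ, 0 < ε → |B v w| ≤ M * (2 * a * b + ε * (a + b)) := by
    intro ε hε
    have hr : 0 < (b + ε) / (a + ε) := by positivity
    -- `s² = b / a` would balance the two terms; adding `ε` to both norms covers the case that one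
    -- of them vanishes.
    have h1 := key (Real.sqrt ((b + ε) / (a + ε))) (Real.sqrt_pos.2 hr)
    rw [inv_pow, Real.sq_sqrt hr.le, inv_div] at h1
    refine h1.trans (mul_le_mul_of_nonneg_left ?_ hM)
    have h2 : (b + ε) / (a + ε) * a ^ 2 ≤ (b + ε) * a := by
      rw [div_mul_eq_mul_div, div_le_iff₀ (by positivity)]
      nlinarith [mul_nonneg (mul_nonneg (add_nonneg hb hε.le) ha) hε.le]
    have h3 : (a + ε) / (b + ε) * b ^ 2 ≤ (a + ε) * b := by
      rw [div_mul_eq_mul_div, div_le_iff₀ (by positivity)]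
      nlinarith [mul_nonneg (mul_nonneg (add_nonneg ha hε.le) hb) hε.le]
    linarith
  refine le_of_forall_pos_le_add fun δ hδ ↦ ?_
  have h1 := key2 (δ / (M * (a + b) + 1)) (by positivity)
  have h2 : M * (δ / (M * (a + b) + 1) * (a + b)) ≤ δ := by
    rw [div_mul_eq_mul_div, mul_div_assoc', div_le_iff₀ (by positivity)]
    nlinarith
  linarith

/-- The drift form on test functions as a bilinear map. -/
def driftBilin {Ω : Opens (Rd d)} {β : Rd d → Rd d}
    (hΩ : Bornology.IsBounded (Ω : Set (Rd d))) (hβ : IsC1UpToBoundary Ω β) :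
    𝓓(Ω, ℝ) →ₗ[ℝ] 𝓓(Ω, ℝ) →ₗ[ℝ] ℝ :=
  (innerₗ (L2 Ω)).compl₁₂ (driftL2 hΩ hβ) (testL2ₗ Ω)

theorem driftBilin_apply {Ω : Opens (Rd d)} {β : Rd d → Rd d}
    (hΩ : Bornology.IsBounded (Ω : Set (Rd d))) (hβ : IsC1UpToBoundary Ω β) (φ ψ : 𝓓(Ω, ℝ)) :
    driftBilin hΩ hβ φ ψ = driftForm Ω β φ ψ := (driftForm_eq_inner hΩ hβ φ ψ).symm

theorem enorm_sq_ofTest {Ω : Opens (Rd d)} (hΩ : Bornology.IsBounded (Ω : Set (Rd d))) {t : ℝ}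
    (ht : 0 ≤ t) (φ : 𝓓(Ω, ℝ)) :
    ENNReal.ofReal (‖TildeH.ofTestₗ ht Ω φ‖ ^ 2) =
      energy (sobolevWeight t) (zeroExt Ω (testL2 φ)) :=
  TildeH.enorm_sq_eq_energy hΩ _

theorem abs_driftForm_le_of_enorm_le {Ω : Opens (Rd d)} {β : Rd d → Rd d}
    (hΩ : Bornology.IsBounded (Ω : Set (Rd d))) {t : ℝ} (ht : 0 ≤ t) {M : ℝ≥0} {φ ψ : 𝓓(Ω, ℝ)}
    (h : ‖driftForm Ω β φ ψ‖ₑ ≤ ENNReal.ofReal (supNorm Ω β) * (M *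
      (energy (sobolevWeight t) (zeroExt Ω (testL2 φ)) +
        energy (sobolevWeight t) (zeroExt Ω (testL2 ψ))))) :
    |driftForm Ω β φ ψ| ≤ M * supNorm Ω β *
      (‖TildeH.ofTestₗ ht Ω φ‖ ^ 2 + ‖TildeH.ofTestₗ ht Ω ψ‖ ^ 2) := by
  rw [← enorm_sq_ofTest hΩ ht, ← enorm_sq_ofTest hΩ ht, ← ENNReal.ofReal_add (by positivity)
    (by positivity), ← ENNReal.ofReal_coe_nnreal, ← ENNReal.ofReal_mul M.coe_nonneg,
    ← ENNReal.ofReal_mul (supNorm_nonneg Ω β), ← ofReal_norm,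
    ENNReal.ofReal_le_ofReal_iff (mul_nonneg (supNorm_nonneg Ω β) (by positivity))] at h
  rw [← Real.norm_eq_abs]
  exact h.trans_eq (by ring)

/-- The drift form is bounded in `H̃¹(Ω)`. -/
theorem abs_driftForm_le_one {Ω : Opens (Rd d)} {β : Rd d → Rd d}
    (hΩ : Bornology.IsBounded (Ω : Set (Rd d))) (hβ : IsC1UpToBoundary Ω β) (φ ψ : 𝓓(Ω, ℝ)) :
    |driftForm Ω β φ ψ| ≤ 2 * supNorm Ω β * ‖TildeH.ofTestₗ zero_le_one Ω φ‖ *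
      ‖TildeH.ofTestₗ zero_le_one Ω ψ‖ := by
  rw [← driftBilin_apply hΩ hβ]
  refine abs_le_mul_norm_of_abs_le_add_sq _ _ (supNorm_nonneg Ω β) (fun φ ψ ↦ ?_) φ ψ
  rw [driftBilin_apply hΩ hβ]
  have h := abs_driftForm_le_of_enorm_le (β := β) hΩ zero_le_one (M := 1) (φ := φ) (ψ := ψ) ?_
  · simpa using h
  refine (enorm_driftForm_le_energy hΩ hβ φ ψ one_ne_zero ENNReal.one_ne_top).trans ?_
  rw [ENNReal.coe_one, one_mul, one_mul, inv_one, one_mul, add_comm]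
  gcongr
  · refine energy_mono (fun ξ ↦ ?_) _
    rw [sobolevWeight, mul_one, Real.rpow_two]
    linarith
  · exact energy_mono (one_le_sobolevWeight 1) _

/-- The crude `H̃¹` bound suffices, since `φ` and `ψ` are fixed and no rate of convergence is
needed. -/
theorem ShiftCover.tendsto_driftForm_smooth {Ω : Opens (Rd d)} {β : Rd d → Rd d}
    (S : ShiftCover (Ω : Set (Rd d))) (hΩ : Bornology.IsBounded (Ω : Set (Rd d)))
    (hβ : IsC1UpToBoundary Ω β) (φ ψ : 𝓓(Ω, ℝ)) :
    Filter.Tendsto (fun n ↦ driftForm Ω β (S.smooth hΩ (testL2 φ) n) (S.smooth hΩ (testL2 ψ) n))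
      Filter.atTop (nhds (driftForm Ω β φ ψ)) := by
  let e := TildeH.ofTestₗ (d := d) zero_le_one Ω
  have hφ : Filter.Tendsto (fun n ↦ e (S.smooth hΩ (testL2 φ) n)) Filter.atTop (nhds (e φ)) :=
    S.tendsto_ofTest_smooth hΩ zero_le_one le_rfl (e φ)
  have hψ : Filter.Tendsto (fun n ↦ e (S.smooth hΩ (testL2 ψ) n)) Filter.atTop (nhds (e ψ)) :=
    S.tendsto_ofTest_smooth hΩ zero_le_one le_rfl (e ψ)
  set a := S.smooth hΩ (testL2 φ)
  set b := S.smooth hΩ (testL2 ψ)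
  have hbound : ∀ n, ‖driftForm Ω β (a n) (b n) - driftForm Ω β φ ψ‖ ≤
      2 * supNorm Ω β * ‖e (a n) - e φ‖ * ‖e (b n)‖ +
        2 * supNorm Ω β * ‖e φ‖ * ‖e (b n) - e ψ‖ := by
    intro n
    have h1 : driftForm Ω β (a n) (b n) - driftForm Ω β φ ψ =
        driftForm Ω β (a n - φ) (b n) + driftForm Ω β φ (b n - ψ) := by
      simp only [← driftBilin_apply hΩ hβ, map_sub, LinearMap.sub_apply]
      ring
    rw [h1, ← map_sub, ← map_sub]
    exact (norm_add_le _ _).trans (add_le_add (abs_driftForm_le_one hΩ hβ _ _)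
      (abs_driftForm_le_one hΩ hβ _ _))
  rw [tendsto_iff_norm_sub_tendsto_zero]
  refine squeeze_zero (fun _ ↦ norm_nonneg _) hbound ?_
  have h2 := ((tendsto_iff_norm_sub_tendsto_zero.1 hφ).const_mul (2 * supNorm Ω β)).mul hψ.norm
  have h3 := (tendsto_iff_norm_sub_tendsto_zero.1 hψ).const_mul (2 * supNorm Ω β * ‖e φ‖)
  simpa using h2.add h3

/-- The drift form is bounded in `H̃^{1/2}(Ω)`, with a bound that depends on the drift only through
its supremum. -/
theorem ShiftCover.exists_abs_driftForm_le {Ω : Opens (Rd d)} (S : ShiftCover (Ω : Set (Rd d)))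
    (hΩ : Bornology.IsBounded (Ω : Set (Rd d))) :
    ∃ K : ℝ≥0, ∀ β : Rd d → Rd d, IsC1UpToBoundary Ω β → IsSolenoidal Ω β → ∀ φ ψ : 𝓓(Ω, ℝ),
      |driftForm Ω β φ ψ| ≤ 2 * (K * supNorm Ω β) *
        ‖TildeH.ofTestₗ (one_half_pos (α := ℝ)).le Ω φ‖ *
          ‖TildeH.ofTestₗ (one_half_pos (α := ℝ)).le Ω ψ‖ := by
  obtain ⟨K, hK⟩ := S.exists_squareFunction_le hΩ
  -- The energy of `φ` is counted four times below: once in the initial term, once in the gradients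
  -- and twice in the differences. That of `ψ` is counted three times.
  refine ⟨4 * K, fun β hβ hdiv φ ψ ↦ ?_⟩
  rw [← driftBilin_apply hΩ hβ]
  refine abs_le_mul_norm_of_abs_le_add_sq _ _
    (mul_nonneg (4 * K).coe_nonneg (supNorm_nonneg Ω β)) (fun φ ψ ↦ ?_) φ ψ
  rw [driftBilin_apply hΩ hβ]
  apply abs_driftForm_le_of_enorm_le hΩ
  set a := S.smooth hΩ (testL2 φ)
  set b := S.smooth hΩ (testL2 ψ)
  set Eφ := energy (sobolevWeight (1 / 2)) (zeroExt Ω (testL2 φ))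
  set Eψ := energy (sobolevWeight (1 / 2)) (zeroExt Ω (testL2 ψ))
  let L : 𝓓(Ω, ℝ) → ℝ≥0∞ := fun φ ↦ energy (fun _ ↦ 1) (zeroExt Ω (testL2 φ))
  let G : 𝓓(Ω, ℝ) → ℝ≥0∞ := fun φ ↦
    energy (fun ξ ↦ (2 * Real.pi * ‖ξ‖) ^ 2) (zeroExt Ω (testL2 φ))
  set s := ENNReal.ofReal (supNorm Ω β)
  have hle : ∀ (f g : 𝓓(Ω, ℝ)) (n : ℕ),
      ‖driftForm Ω β f g‖ₑ ≤ s * (2 ^ n * L g + (2 ^ n)⁻¹ * G f) := fun f g n ↦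
    enorm_driftForm_le_energy hΩ hβ f g (by positivity) (by finiteness)
  have hLsub : ∀ f g : 𝓓(Ω, ℝ), L (f - g) = energy (fun _ ↦ 1)
      (zeroExt Ω (testL2 f - testL2 g)) := fun f g ↦ by
    change energy _ (zeroExt Ω (testL2ₗ Ω (f - g))) = _
    rw [map_sub]
    rfl
  refine le_of_tendsto (S.tendsto_driftForm_smooth hΩ hβ φ ψ).enorm (.of_forall fun N ↦ ?_)
  have hstep : ∀ n, ‖driftForm Ω β (a (n + 1)) (b (n + 1)) - driftForm Ω β (a n) (b n)‖ₑ ≤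
      s * ((2 ^ n * L (b (n + 1) - b n) + (2 ^ n)⁻¹ * G (a n)) +
        (2 * (2 ^ n * L (a (n + 1) - a n)) + (2 ^ (n + 1))⁻¹ * G (b (n + 1)))) := by
    intro n
    -- Antisymmetry keeps the gradient off the differences, which are controlled only in `L²`.
    have h1 : driftForm Ω β (a (n + 1)) (b (n + 1)) - driftForm Ω β (a n) (b n) =
        driftForm Ω β (a n) (b (n + 1) - b n) -
          driftForm Ω β (b (n + 1)) (a (n + 1) - a n) := by
      rw [driftForm_antisymm hβ hdiv (b (n + 1))]
      simp only [← driftBilin_apply hΩ hβ, map_sub, LinearMap.sub_apply]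
      ring
    rw [h1, mul_add]
    -- The second term has the gradient of `b (n + 1)`, so its weight is `2^(n + 1)`; this is the
    -- source of the factor 2 in front of the differences of `a`.
    refine enorm_sub_le.trans (add_le_add (hle _ _ n) ((hle _ _ (n + 1)).trans_eq ?_))
    ring
  have htel : driftForm Ω β (a N) (b N) = driftForm Ω β (a 0) (b 0) +
      ∑ n ∈ Finset.range N,
        (driftForm Ω β (a (n + 1)) (b (n + 1)) - driftForm Ω β (a n) (b n)) := by
    rw [Finset.sum_range_sub fun n ↦ driftForm Ω β (a n) (b n)]
    ring
  have h0 : ‖driftForm Ω β (a 0) (b 0)‖ₑ ≤ s * (K * Eψ + K * Eφ) := by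
    refine (hle _ _ 0).trans ?_
    refine mul_le_mul' le_rfl (add_le_add ?_ ?_)
    · rw [pow_zero, one_mul]
      exact (hK (testL2 ψ) 0).2.2
    · have h1 := (hK (testL2 φ) 1).2.1
      rwa [Finset.sum_range_one] at h1
  have hS : ∑ n ∈ Finset.range N, ‖driftForm Ω β (a (n + 1)) (b (n + 1)) -
      driftForm Ω β (a n) (b n)‖ₑ ≤ s * ((K * Eψ + K * Eφ) + (2 * (K * Eφ) + K * Eψ)) := by
    refine (Finset.sum_le_sum fun n _ ↦ hstep n).trans ?_
    rw [← Finset.mul_sum, Finset.sum_add_distrib, Finset.sum_add_distrib, Finset.sum_add_distrib,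
      ← Finset.mul_sum]
    simp only [hLsub]
    gcongr
    · exact (hK (testL2 ψ) N).1
    · exact (hK (testL2 φ) N).2.1
    · exact (hK (testL2 φ) N).1
    -- The gradients of `b` are indexed from 1, so their sum is that over `range (N + 1)` without
    -- its first term.
    · refine le_trans ?_ (hK (testL2 ψ) (N + 1)).2.1
      rw [Finset.sum_range_succ']
      exact le_self_add
  rw [htel]
  calc _ ≤ s * (K * Eψ + K * Eφ) + s * ((K * Eψ + K * Eφ) + (2 * (K * Eφ) + K * Eψ)) :=
        (enorm_add_le _ _).trans (add_le_add h0 ((enorm_sum_le _ _).trans hS))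
    _ = s * (K * (4 * Eφ + 3 * Eψ)) := by ring
    _ ≤ s * (K * (4 * Eφ + 4 * Eψ)) := by gcongr; norm_num
    _ = _ := by push_cast; ring

/-! ### From `1/2` to `t`, and density of test functions -/

theorem sobolevWeight_half_le {t : ℝ} (ht : 1 / 2 ≤ t) (ξ : Rd d) :
    sobolevWeight (1 / 2) ξ ≤ 2 * sobolevWeight t ξ := by
  rw [sobolevWeight, sobolevWeight, mul_one_div_cancel two_ne_zero, Real.rpow_one]
  set x := 2 * Real.pi * ‖ξ‖
  have h0 : 0 ≤ x ^ (2 * t) := by positivity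
  rcases le_total x 1 with h | h
  · linarith
  · have := Real.self_le_rpow_of_one_le h (by linarith : 1 ≤ 2 * t)
    linarith

theorem norm_ofTest_half_le {Ω : Opens (Rd d)} (hΩ : Bornology.IsBounded (Ω : Set (Rd d))) {t : ℝ}
    (ht₀ : 0 ≤ t) (ht : 1 / 2 ≤ t) (φ : 𝓓(Ω, ℝ)) :
    ‖TildeH.ofTestₗ (one_half_pos (α := ℝ)).le Ω φ‖ ≤ 2 * ‖TildeH.ofTestₗ ht₀ Ω φ‖ := by
  have h1 : energy (sobolevWeight (1 / 2)) (zeroExt Ω (testL2 φ)) ≤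
      ENNReal.ofReal 2 * energy (sobolevWeight t) (zeroExt Ω (testL2 φ)) := by
    rw [energy, energy, ← lintegral_const_mul' _ _ ENNReal.ofReal_ne_top]
    refine lintegral_mono fun ξ ↦ ?_
    rw [← mul_assoc, ← ENNReal.ofReal_mul zero_le_two]
    exact mul_le_mul' (ENNReal.ofReal_le_ofReal (sobolevWeight_half_le ht ξ)) le_rfl
  rw [← enorm_sq_ofTest hΩ ht₀, ← enorm_sq_ofTest hΩ (one_half_pos (α := ℝ)).le,
    ← ENNReal.ofReal_mul zero_le_two, ENNReal.ofReal_le_ofReal_iff (by positivity)] at h1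
  refine le_of_sq_le_sq ?_ (by positivity)
  rw [mul_pow]
  nlinarith [sq_nonneg ‖TildeH.ofTestₗ ht₀ Ω φ‖]

theorem norm_toL2_le {Ω : Opens (Rd d)} (hΩ : Bornology.IsBounded (Ω : Set (Rd d))) {t : ℝ}
    (v : TildeH Ω t) : ‖TildeH.toL2 v‖ ≤ ‖v‖ := by
  have h1 : ENNReal.ofReal (‖TildeH.toL2 v‖ ^ 2) =
      energy (fun _ ↦ 1) (zeroExt Ω (TildeH.toL2 v)) := by
    rw [energy_one (integrable_zeroExt hΩ _) (memLp_zeroExt Ω _), zeroExt,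
      eLpNorm_indicator_eq_eLpNorm_restrict Ω.isOpen.measurableSet,
      ENNReal.ofReal_pow (norm_nonneg _), ofReal_norm, Lp.enorm_def]
    congr 1
    refine eLpNorm_congr_norm_ae (.of_forall fun x ↦ ?_)
    rw [Complex.norm_real]
  have h2 := energy_mono (one_le_sobolevWeight t) (zeroExt Ω (TildeH.toL2 v))
  rw [← h1, ← TildeH.enorm_sq_eq_energy hΩ, ENNReal.ofReal_le_ofReal_iff (by positivity)] at h2
  exact le_of_sq_le_sq h2 (norm_nonneg _)

theorem denseRange_ofTest {Ω : Opens (Rd d)} (S : ShiftCover (Ω : Set (Rd d)))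
    (hΩ : Bornology.IsBounded (Ω : Set (Rd d))) {t : ℝ} (ht₀ : 0 ≤ t) (ht₁ : t ≤ 1) :
    DenseRange (TildeH.ofTestₗ ht₀ Ω) := fun v ↦
  mem_closure_of_tendsto (S.tendsto_ofTest_smooth hΩ ht₀ ht₁ v)
    (.of_forall fun _ ↦ mem_range_self _)

/-- The distribution `β · ∇v` is bounded in `H^{-t}(Ω)`. -/
theorem abs_driftDistribution_le {Ω : Opens (Rd d)} (S : ShiftCover (Ω : Set (Rd d)))
    (hΩ : Bornology.IsBounded (Ω : Set (Rd d))) {t : ℝ} (ht₀ : 0 ≤ t) (ht₁ : t ≤ 1)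
    {β : Rd d → Rd d} (hβ : IsC1UpToBoundary Ω β) (hdiv : IsSolenoidal Ω β) {M : ℝ}
    (hM : ∀ φ ψ : 𝓓(Ω, ℝ), |driftForm Ω β φ ψ| ≤
      M * ‖TildeH.ofTestₗ ht₀ Ω φ‖ * ‖TildeH.ofTestₗ ht₀ Ω ψ‖) (v : TildeH Ω t) (ψ : 𝓓(Ω, ℝ)) :
    |driftDistribution Ω β (TildeH.toL2 v) ψ| ≤ M * ‖v‖ * ‖TildeH.ofTestₗ ht₀ Ω ψ‖ := by
  have hc : Continuous (TildeH.toL2 (Ω := Ω) (t := t)) :=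
    (TildeH.toL2.mkContinuous 1 fun v ↦ by rw [one_mul]; exact norm_toL2_le hΩ v).continuous
  -- For fixed `ψ` both sides are continuous in `v`, because the pairing is continuous in `L²(Ω)`;
  -- on test functions the distribution is the drift form.
  refine (denseRange_ofTest S hΩ ht₀ ht₁).induction_on v ?_ fun φ ↦ ?_
  · simp only [driftDistribution_eq_inner hΩ hβ hdiv]
    exact isClosed_le (by fun_prop) (by fun_prop)
  · have h := driftDistribution_testL2 hΩ hβ hdiv φ ψ
    have h' : TildeH.toL2 (TildeH.ofTestₗ ht₀ Ω φ) = testL2ₗ Ω φ := rfl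
    rw [h', h]
    exact hM φ ψ

end

/-! ### The main theorem -/

theorem mainTheorem8 {d : ℕ} (hd : 1 ≤ d) (Ω : Opens (Rd d))
    (hbdd : Bornology.IsBounded (Ω : Set (Rd d)))
    (hlip : HasLipschitzBoundary (Ω : Set (Rd d))) :
    ∃ C : ℝ, 0 < C ∧
      ∀ (t : ℝ) (ht₀ : 0 ≤ t), 1 / 2 ≤ t → t ≤ 1 →
        ∀ β : Rd d → Rd d, IsC1UpToBoundary Ω β → IsSolenoidal Ω β →
          (∀ v : TildeH Ω t,
            (∃! ℓ : HNeg Ω t, IsDriftTerm ht₀ β v ℓ) ∧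
              ∀ ℓ : HNeg Ω t, IsDriftTerm ht₀ β v ℓ → ‖ℓ‖ ≤ C * supNorm Ω β * ‖v‖) ∧
          (∃! D : TildeH Ω t →L[ℝ] TildeH Ω t →L[ℝ] ℝ, ExtendsDriftForm ht₀ β D) ∧
          ∀ D : TildeH Ω t →L[ℝ] TildeH Ω t →L[ℝ] ℝ, ExtendsDriftForm ht₀ β D →
            ∀ v : TildeH Ω t, D v v = 0 := by
  obtain ⟨S⟩ := hlip.nonempty_shiftCover Ω.isOpen hbdd
  obtain ⟨K, hK⟩ := S.exists_abs_driftForm_le hbdd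
  -- The bound `2 K` in `H̃^{1/2}` picks up a factor 2 from each of the two norm comparisons; the
  -- summand 1 makes the constant positive even if `K = 0`.
  refine ⟨8 * K + 1, by positivity, fun t ht₀ ht ht₁ β hβ hdiv ↦ ?_⟩
  have hS := supNorm_nonneg Ω β
  let e : 𝓓(Ω, ℝ) →ₗ[ℝ] TildeH Ω t := TildeH.ofTestₗ ht₀ Ω
  have hdense : DenseRange e := denseRange_ofTest S hbdd ht₀ ht₁
  set M : ℝ := (8 * K + 1) * supNorm Ω β with hM
  have hM0 : 0 ≤ M := by positivity
  have hform : ∀ φ ψ : 𝓓(Ω, ℝ), |driftForm Ω β φ ψ| ≤ M * ‖e φ‖ * ‖e ψ‖ := by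
    intro φ ψ
    calc _ ≤ 2 * (K * supNorm Ω β) * (2 * ‖e φ‖) * (2 * ‖e ψ‖) := by
          refine (hK β hβ hdiv φ ψ).trans ?_
          gcongr
          · exact norm_ofTest_half_le hbdd ht₀ ht φ
          · exact norm_ofTest_half_le hbdd ht₀ ht ψ
      _ = 8 * K * supNorm Ω β * ‖e φ‖ * ‖e ψ‖ := by ring
      _ ≤ _ := by
          rw [hM]
          gcongr
          linarith
  have hdist := abs_driftDistribution_le S hbdd ht₀ ht₁ hβ hdiv hform
  let g : TildeH Ω t → 𝓓(Ω, ℝ) →ₗ[ℝ] ℝ := fun v ↦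
    -((innerₗ (L2 Ω) (TildeH.toL2 v)).comp (driftL2 hbdd hβ))
  have hg : ∀ v φ, g v φ = driftDistribution Ω β (TildeH.toL2 v) φ := fun v φ ↦
    (driftDistribution_eq_inner hbdd hβ hdiv _ φ).symm
  have hgle : ∀ v φ, ‖g v φ‖ ≤ M * ‖v‖ * ‖e φ‖ := fun v φ ↦ by
    rw [hg]
    exact hdist v φ
  let ℓ : TildeH Ω t → HNeg Ω t := fun v ↦ (g v).extendOfNorm e
  have hℓ : ∀ v, IsDriftTerm ht₀ β v (ℓ v) := fun v φ ↦
    (LinearMap.extendOfNorm_eq hdense ⟨_, hgle v⟩ φ).trans (hg v φ)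
  have hℓnorm : ∀ v, ‖ℓ v‖ ≤ M * ‖v‖ := fun v ↦
    LinearMap.opNorm_extendOfNorm_le hdense (by positivity) (hgle v)
  have hext : ∀ ℓ₁ ℓ₂ : HNeg Ω t, (∀ φ, ℓ₁ (e φ) = ℓ₂ (e φ)) → ℓ₁ = ℓ₂ := fun ℓ₁ ℓ₂ h ↦
    DFunLike.coe_injective (hdense.equalizer ℓ₁.continuous ℓ₂.continuous (funext h))
  have huniq : ∀ v (ℓ' : HNeg Ω t), IsDriftTerm ht₀ β v ℓ' → ℓ' = ℓ v := fun v ℓ' h' ↦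
    hext _ _ fun φ ↦ (h' φ).trans (hℓ v φ).symm
  -- The form is `v ↦ β · ∇v` itself, as a map into the dual. Its linearity follows from the
  -- uniqueness of the extensions.
  let D : TildeH Ω t →L[ℝ] HNeg Ω t := LinearMap.mkContinuous
    { toFun := ℓ
      map_add' := fun v w ↦ (huniq (v + w) _ fun φ ↦ by
        rw [add_apply, hℓ v φ, hℓ w φ, ← hg, ← hg, ← hg]
        simp only [g, map_add, LinearMap.neg_apply, LinearMap.comp_apply, LinearMap.add_apply]
        ring).symm
      map_smul' := fun c v ↦ (huniq (c • v) _ fun φ ↦ by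
        rw [RingHom.id_apply, smul_apply, hℓ v φ, ← hg, ← hg]
        simp only [g, map_smul, LinearMap.neg_apply, LinearMap.comp_apply, LinearMap.smul_apply,
          smul_neg]).symm } M hℓnorm
  have hD : ExtendsDriftForm ht₀ β D := fun φ ψ ↦
    (hℓ (e φ) ψ).trans (driftDistribution_testL2 hbdd hβ hdiv φ ψ)
  refine ⟨fun v ↦ ⟨⟨ℓ v, hℓ v, huniq v⟩, fun ℓ' h' ↦ ?_⟩, ⟨D, hD, fun D' hD' ↦ ?_⟩,
    fun D' hD' v ↦ ?_⟩
  · rw [huniq v ℓ' h']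
    exact hℓnorm v
  · refine DFunLike.coe_injective (hdense.equalizer D'.continuous D.continuous (funext fun φ ↦ ?_))
    exact hext _ _ fun ψ ↦ (hD' φ ψ).trans (hD φ ψ).symm
  -- On test functions antisymmetry gives `D(φ, φ) = -D(φ, φ)`, and the zero set of the continuous
  -- map `v ↦ D(v, v)` is closed.
  · refine hdense.induction_on v (isClosed_eq (by fun_prop) continuous_const) fun φ ↦ ?_
    have h1 := driftForm_antisymm hβ hdiv φ φ
    exact (hD' φ φ).trans (by linarith)
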